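/- Let $n\ge 0$ and let $\Sigma^1,\dots,\Sigma^n$ be (connected, Hausdorff) Riemann surfaces, each endowed with a Kähler metric, i.e. a smooth Riemannian metric for which the complex structure is orthogonal, whose scalar curvature is nonpositive everywhere. For $j=1,\dots,n$ let $\gamma_j\colon S^1=\mathbb{R}/\mathbb{Z}\to\Sigma^j$ be a (nonconstant) closed geodesic. Let $M=\Sigma^1\times\cdots\times\Sigma^n$ be the product complex manifold, and let $\mathbb{D}$ be the open unit disc in $\mathbb{C}$. (1) If the closed geodesics $\gamma_j$ are simple (injective), so that $L=\gamma_1(S^1)\times\cdots\times\gamma_n(S^1)$ is an embedded submanifold of $M$, then there is no nonconstant continuous map $f\colon\overline{\mathbb{D}}\to M$, holomorphic on $\mathbb{D}$, such that $f(\partial\mathbb{D})\subseteq L$. (2) If the $\gamma_j$ are arbitrary closed geodesics, possibly with self-intersections, so that $\gamma_1\times\cdots\times\gamma_n\colon (S^1)^n\to M$ is an immersed torus, then there is no nonconstant continuous map $f\colon\overline{\mathbb{D}}\to M$, holomorphic on $\mathbb{D}$, whose boundary values lie on this immersed torus in the sense that $f|_{\partial\mathbb{D}}=(\gamma_1\times\cdots\times\gamma_n)\circ\tau$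 for some continuous map $\tau\colon\partial\mathbb{D}\to(S^1)^n$. -/

import Mathlib

open scoped Manifold ContDiff

noncomputable section

/-- A Riemann surface, viewed as a smooth real surface modelled on `ℂ = ℝ²`. -/
instance RiemannSurface.isManifold_real (S : Type*) [TopologicalSpace S] [ChartedSpace ℂ S]
    [h : IsManifold 𝓘(ℂ) ω S] : IsManifold 𝓘(ℝ, ℂ) ∞ S := by
  refine isManifold_of_contDiffOn 𝓘(ℝ, ℂ) ∞ S fun e e' he he' ↦ ?_
  have h1 := (contDiffGroupoid ω 𝓘(ℂ)).compatible he he'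
  rw [contDiffGroupoid, mem_groupoid_of_pregroupoid] at h1
  have h2 := h1.1
  simp only [contDiffPregroupoid] at h2
  exact (h2.restrict_scalars ℝ).of_le le_top

/-- The complex structure `J` on the tangent spaces of a Riemann surface: multiplication by `i`
in the holomorphic coordinate `chartAt ℂ p`, through which Mathlib identifies `T_p S` with `ℂ`. -/
def complexStructure {S : Type*} [TopologicalSpace S] [ChartedSpace ℂ S] (p : S)
    (v : TangentSpace 𝓘(ℝ, ℂ) p) : TangentSpace 𝓘(ℝ, ℂ) p :=
  (Complex.I * (show ℂ from v) : ℂ)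

/-- A Kähler metric on a Riemann surface: a smooth Riemannian metric for which `J` is
orthogonal. (The form `g(J·,·)` is closed for reasons of dimension.) -/
structure KahlerMetric (S : Type*) [TopologicalSpace S] [ChartedSpace ℂ S]
    [IsManifold 𝓘(ℂ) ω S] where
  /-- The underlying Riemannian metric. -/
  toMetric : Bundle.ContMDiffRiemannianMetric 𝓘(ℝ, ℂ) ∞ ℂ
    (TangentSpace 𝓘(ℝ, ℂ) : S → Type _)
  /-- `J` is orthogonal. -/
  inner_J : ∀ (p : S) (v w : TangentSpace 𝓘(ℝ, ℂ) p),
    toMetric.inner p (complexStructure p v) (complexStructure p w) = toMetric.inner p v w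

namespace KahlerMetric

variable {S : Type*} [TopologicalSpace S] [ChartedSpace ℂ S] [IsManifold 𝓘(ℂ) ω S]

/-- In a holomorphic coordinate `z = x + i y` given by the chart `φ`, a Kähler metric is
`e ^ σ |dz|²`, where `e ^ σ = g(∂_x, ∂_x)`. This is the function `e ^ σ`, meaningful on
`φ.target`. -/
def density (g : KahlerMetric S) (φ : OpenPartialHomeomorph S ℂ) (z : ℂ) : ℝ :=
  let X : TangentSpace 𝓘(ℝ, ℂ) (φ.symm z) := mfderiv 𝓘(ℝ, ℂ) 𝓘(ℝ, ℂ) φ.symm z (1 : ℂ)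
  g.toMetric.inner (φ.symm z) X X

/-- The function `σ` for which the metric is `e ^ σ |dz|²` in the coordinate given by `φ`. -/
def logDensity (g : KahlerMetric S) (φ : OpenPartialHomeomorph S ℂ) (z : ℂ) : ℝ :=
  Real.log (g.density φ z)

/-- The scalar curvature (twice the Gaussian curvature), `- e ^ (-σ) Δσ`, computed in the
holomorphic coordinate around `p`. -/
def scalarCurvature (g : KahlerMetric S) (p : S) : ℝ :=
  -(Laplacian.laplacian (g.logDensity (chartAt ℂ p)) (chartAt ℂ p p) /
    g.density (chartAt ℂ p) (chartAt ℂ p p))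

/-- The Christoffel symbol `Γ = ∂σ/∂z = (∂σ/∂x - i ∂σ/∂y) / 2` of the Levi-Civita connection
in the coordinate given by `φ`. -/
def christoffel (g : KahlerMetric S) (φ : OpenPartialHomeomorph S ℂ) (z : ℂ) : ℂ :=
  ((fderiv ℝ (g.logDensity φ) z 1 : ℝ) - Complex.I * (fderiv ℝ (g.logDensity φ) z Complex.I : ℝ)) / 2

/-- Geodesics: smooth curves whose coordinate expression `w` solves the geodesic equation
`w'' + Γ(w) (w')² = 0`. -/
def IsGeodesic (g : KahlerMetric S) (c : ℝ → S) : Prop :=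
  ContMDiff 𝓘(ℝ) 𝓘(ℝ, ℂ) ∞ c ∧
    ∀ t : ℝ,
      let φ := chartAt ℂ (c t)
      let w : ℝ → ℂ := fun s ↦ φ (c s)
      deriv (deriv w) t + g.christoffel φ (w t) * (deriv w t) ^ 2 = 0

/-- Closed geodesics: nonconstant maps `γ : S¹ = ℝ/ℤ → S` which are geodesics as periodic
curves on `ℝ`. -/
def IsClosedGeodesic (g : KahlerMetric S) (γ : UnitAddCircle → S) : Prop :=
  g.IsGeodesic (fun t : ℝ ↦ γ (t : UnitAddCircle)) ∧ ∃ s t, γ s ≠ γ t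

end KahlerMetric

/-- `f`, restricted to the closed unit disc, is a nonconstant continuous map into the product
complex manifold `∏ j, S j`, holomorphic on the open unit disc. -/
def IsNonconstantHolomorphicDisc {n : ℕ} {S : Fin n → Type*} [∀ j, TopologicalSpace (S j)]
    [∀ j, ChartedSpace ℂ (S j)] (f : ℂ → ∀ j, S j) : Prop :=
  ContinuousOn f (Metric.closedBall 0 1) ∧
    MDifferentiableOn 𝓘(ℂ) (ModelWithCorners.pi fun _ : Fin n ↦ 𝓘(ℂ)) f (Metric.ball 0 1) ∧
    ∃ z ∈ Metric.closedBall (0 : ℂ) 1, ∃ w ∈ Metric.closedBall (0 : ℂ) 1, f z ≠ f w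

end

open Metric Set

namespace KahlerMetric
variable {S : Type*} [TopologicalSpace S] [ChartedSpace ℂ S] [IsManifold 𝓘(ℂ) ω S]

theorem contDiffOn_density (g : KahlerMetric S) {φ : OpenPartialHomeomorph S ℂ}
    (hφ : φ ∈ atlas ℂ S) : ContDiffOn ℝ ∞ (g.density φ) φ.target := by
  rw [← contMDiffOn_iff_contDiffOn]
  have h0 : ContMDiffOn 𝓘(ℝ, ℂ) 𝓘(ℝ, ℂ) ∞ φ.symm φ.target :=
    contMDiffOn_symm_of_mem_maximalAtlas (IsManifold.subset_maximalAtlas hφ)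
  have hU := φ.open_target.uniqueMDiffOn (I := 𝓘(ℝ, ℂ))
  have h1 := h0.contMDiffOn_tangentMapWithin (m := ∞) (by simp) hU
  intro w hw
  have h2 : ContMDiffWithinAt 𝓘(ℝ, ℂ) (𝓘(ℝ, ℂ).prod 𝓘(ℝ, ℂ)) ∞ (fun w : ℂ ↦
      (⟨φ.symm w, mfderiv 𝓘(ℝ, ℂ) 𝓘(ℝ, ℂ) φ.symm w (1 : ℂ)⟩ :
        TangentBundle 𝓘(ℝ, ℂ) S)) φ.target w := by
    have hc : ContMDiff 𝓘(ℝ, ℂ) (𝓘(ℝ, ℂ).prod 𝓘(ℝ, ℂ)) ∞ (fun w : ℂ ↦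
        (⟨w, (1 : ℂ)⟩ : TangentBundle 𝓘(ℝ, ℂ) ℂ)) :=
      contMDiff_vectorSpace_iff_contDiff.2 contDiff_const
    have := (h1 ⟨w, (1 : ℂ)⟩ hw).comp w (hc.contMDiffAt.contMDiffWithinAt
      (s := φ.target)) (fun x hx ↦ hx)
    refine this.congr (fun x hx ↦ ?_) ?_
    · simp only [Function.comp_apply, tangentMapWithin]
      rw [mfderivWithin_of_isOpen φ.open_target hx]
    · simp only [Function.comp_apply, tangentMapWithin]
      rw [mfderivWithin_of_isOpen φ.open_target hw]
  have h3 : ContMDiffWithinAt 𝓘(ℝ, ℂ) (𝓘(ℝ, ℂ).prod 𝓘(ℝ, ℂ →L[ℝ] ℂ →L[ℝ] ℝ)) ∞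
      (fun w : ℂ ↦ Bundle.TotalSpace.mk' (ℂ →L[ℝ] ℂ →L[ℝ] ℝ)
        (E := fun x : S ↦ TangentSpace 𝓘(ℝ, ℂ) x →L[ℝ] TangentSpace 𝓘(ℝ, ℂ) x →L[ℝ] ℝ)
        (φ.symm w) (g.toMetric.inner (φ.symm w)))
      φ.target w :=
     g.toMetric.contMDiff.contMDiffAt.comp_contMDiffWithinAt w (h0 w hw)
  have h4 := ContMDiffWithinAt.clm_bundle_apply₂ (F₁ := ℂ) (F₂ := ℂ) (F₃ := ℝ)
    (E₃ := Bundle.Trivial S ℝ) h3 h2 h2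
  simp only [Bundle.contMDiffWithinAt_totalSpace] at h4
  exact h4.2

/-- The squared length of the tangent vector at `p` with coordinate `1` in `chartAt ℂ p`. -/
noncomputable def unitNormSq (g : KahlerMetric S) (p : S) : ℝ :=
  let X : TangentSpace 𝓘(ℝ, ℂ) p := (1 : ℂ)
  g.toMetric.inner p X X

theorem unitNormSq_pos (g : KahlerMetric S) (p : S) : 0 < g.unitNormSq p :=
  g.toMetric.pos p _ (one_ne_zero (α := ℂ))

theorem inner_self_eq (g : KahlerMetric S) (p : S) (v : ℂ) :
    (let X : TangentSpace 𝓘(ℝ, ℂ) p := v; g.toMetric.inner p X X) =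
      ‖v‖ ^ 2 * g.unitNormSq p := by
  set X : TangentSpace 𝓘(ℝ, ℂ) p := (1 : ℂ) with hX
  have hv : (show TangentSpace 𝓘(ℝ, ℂ) p from v) = v.re • X + v.im • complexStructure p X := by
    change v = v.re • (1 : ℂ) + v.im • (Complex.I * 1)
    apply Complex.ext <;> simp
  have hJJ : complexStructure p (complexStructure p X) = -X := by
    change Complex.I * (Complex.I * 1) = -(1 : ℂ)
    rw [mul_one, Complex.I_mul_I]
  have h1 := g.inner_J p X X
  have h2 := g.inner_J p X (complexStructure p X)
  have h3 := g.toMetric.symm p X (complexStructure p X)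
  rw [hJJ, map_neg] at h2
  have h4 : g.toMetric.inner p X (complexStructure p X) = 0 := by linarith
  have h5 : g.toMetric.inner p (complexStructure p X) X = 0 := by linarith
  have h6 : g.toMetric.inner p X X = g.unitNormSq p := rfl
  have key : g.toMetric.inner p (v.re • X + v.im • complexStructure p X)
      (v.re • X + v.im • complexStructure p X) = ‖v‖ ^ 2 * g.unitNormSq p := by
    simp only [map_add, map_smul, add_apply, smul_apply, smul_eq_mul, h1, h4, h5, h6]
    rw [← Complex.normSq_eq_norm_sq, Complex.normSq_apply]
    ring
  exact (congrArg (fun Y : TangentSpace 𝓘(ℝ, ℂ) p ↦ g.toMetric.inner p Y Y) hv).trans key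

theorem contDiffAt_transition {φ ψ : OpenPartialHomeomorph S ℂ} (hφ : φ ∈ atlas ℂ S)
    (hψ : ψ ∈ atlas ℂ S) {w : ℂ} (hw : w ∈ φ.target) (hw' : φ.symm w ∈ ψ.source) :
    ContDiffAt ℂ ω (fun x ↦ ψ (φ.symm x)) w := by
  have h1 := (contDiffGroupoid ω 𝓘(ℂ)).compatible hφ hψ
  rw [contDiffGroupoid, mem_groupoid_of_pregroupoid] at h1
  have h2 := h1.1
  simp only [contDiffPregroupoid] at h2
  have h3 : w ∈ (φ.symm ≫ₕ ψ).source := by simp [hw, hw']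
  have := (h2.contDiffAt (x := w) (by simpa using (φ.symm ≫ₕ ψ).open_source.mem_nhds h3))
  exact this

theorem density_eq (g : KahlerMetric S) {φ : OpenPartialHomeomorph S ℂ} (hφ : φ ∈ atlas ℂ S)
    {w : ℂ} (hw : w ∈ φ.target) :
    g.density φ w = ‖deriv (fun x ↦ chartAt ℂ (φ.symm w) (φ.symm x)) w‖ ^ 2 *
      g.unitNormSq (φ.symm w) := by
  have h1 : MDifferentiableAt 𝓘(ℝ, ℂ) 𝓘(ℝ, ℂ) φ.symm w := mdifferentiableAt_atlas_symm hφ hw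
  have h2 : DifferentiableAt ℂ (fun x ↦ chartAt ℂ (φ.symm w) (φ.symm x)) w :=
    (contDiffAt_transition hφ (chart_mem_atlas ℂ _) hw (mem_chart_source _ _)).differentiableAt
      (by simp)
  have hF : HasFDerivAt (fun x : ℂ ↦ chartAt ℂ (φ.symm w) (φ.symm x))
      (fderiv ℝ (fun x : ℂ ↦ chartAt ℂ (φ.symm w) (φ.symm x)) w) w :=
    (h2.restrictScalars ℝ).hasFDerivAt
  have h3 : HasMFDerivAt 𝓘(ℝ, ℂ) 𝓘(ℝ, ℂ) φ.symm w
      (fderiv ℝ (fun x : ℂ ↦ chartAt ℂ (φ.symm w) (φ.symm x)) w) := by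
    refine ⟨h1.continuousAt, ?_⟩
    exact hF.hasFDerivWithinAt
  have h5 : fderiv ℝ (fun x : ℂ ↦ chartAt ℂ (φ.symm w) (φ.symm x)) w 1 =
      deriv (fun x ↦ chartAt ℂ (φ.symm w) (φ.symm x)) w := by
    rw [h2.fderiv_restrictScalars ℝ]
    simp
  have h4 : mfderiv 𝓘(ℝ, ℂ) 𝓘(ℝ, ℂ) φ.symm w (1 : ℂ) =
      deriv (fun x ↦ chartAt ℂ (φ.symm w) (φ.symm x)) w :=
    (congrArg (fun L : ℂ →L[ℝ] ℂ ↦ L 1) h3.mfderiv).trans h5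
  refine Eq.trans ?_ (inner_self_eq g (φ.symm w) _)
  rw [density, ← h4]

theorem deriv_transition_ne_zero {φ ψ : OpenPartialHomeomorph S ℂ} (hφ : φ ∈ atlas ℂ S)
    (hψ : ψ ∈ atlas ℂ S) {w : ℂ} (hw : w ∈ φ.target) (hw' : φ.symm w ∈ ψ.source) :
    deriv (fun x ↦ ψ (φ.symm x)) w ≠ 0 := by
  have h1 : DifferentiableAt ℂ (fun x ↦ ψ (φ.symm x)) w :=
    (contDiffAt_transition hφ hψ hw hw').differentiableAt (by simp)
  have h2 : DifferentiableAt ℂ (fun x ↦ φ (ψ.symm x)) (ψ (φ.symm w)) :=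
    (contDiffAt_transition hψ hφ (ψ.map_source hw')
      (by rw [ψ.left_inv hw']; exact φ.map_target hw)).differentiableAt (by simp)
  have h3 : (fun x ↦ φ (ψ.symm x)) ∘ (fun x ↦ ψ (φ.symm x)) =ᶠ[nhds w] id := by
    filter_upwards [φ.open_target.mem_nhds hw,
      φ.continuousAt_symm hw (ψ.open_source.mem_nhds hw')] with x hx hx'
    simp [ψ.left_inv hx', φ.right_inv hx]
  have h4 := h3.deriv_eq
  rw [deriv_comp w h2 h1, deriv_id] at h4
  exact right_ne_zero_of_mul_eq_one h4

/-- The squared length of the derivative of a map from a plane domain. -/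
noncomputable def normDerivSq (g : KahlerMetric S) (f : ℂ → S) (z : ℂ) : ℝ :=
  ‖deriv (fun x ↦ chartAt ℂ (f z) (f x)) z‖ ^ 2 * g.unitNormSq (f z)

theorem normDerivSq_eq (g : KahlerMetric S) {φ : OpenPartialHomeomorph S ℂ} (hφ : φ ∈ atlas ℂ S)
    {f : ℂ → S} {z : ℂ} (hf : ContinuousAt f z) (hz : f z ∈ φ.source)
    (hd : DifferentiableAt ℂ (fun x ↦ φ (f x)) z) :
    g.normDerivSq f z = g.density φ (φ (f z)) * ‖deriv (fun x ↦ φ (f x)) z‖ ^ 2 := by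
  have hw : φ (f z) ∈ φ.target := φ.map_source hz
  rw [density_eq g hφ hw, normDerivSq, φ.left_inv hz]
  have h2 : DifferentiableAt ℂ (fun x ↦ chartAt ℂ (f z) (φ.symm x)) (φ (f z)) :=
    (contDiffAt_transition hφ (chart_mem_atlas ℂ _) hw
      (by rw [φ.left_inv hz]; exact mem_chart_source _ _)).differentiableAt (by simp)
  have h3 : (fun x ↦ chartAt ℂ (f z) (f x)) =ᶠ[nhds z]
      (fun x ↦ chartAt ℂ (f z) (φ.symm x)) ∘ (fun x ↦ φ (f x)) := by
    filter_upwards [hf (φ.open_source.mem_nhds hz)] with x hx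
    simp [φ.left_inv hx]
  rw [h3.deriv_eq, deriv_comp z h2 hd, norm_mul]
  ring

theorem density_pos (g : KahlerMetric S) {φ : OpenPartialHomeomorph S ℂ} (hφ : φ ∈ atlas ℂ S)
    {w : ℂ} (hw : w ∈ φ.target) : 0 < g.density φ w := by
  rw [density_eq g hφ hw]
  have := deriv_transition_ne_zero hφ (chart_mem_atlas ℂ (φ.symm w)) hw (mem_chart_source _ _)
  have := g.unitNormSq_pos (φ.symm w)
  positivity

/-- Transformation of the density under a change of chart. -/
theorem density_transition (g : KahlerMetric S) {φ ψ : OpenPartialHomeomorph S ℂ}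
    (hφ : φ ∈ atlas ℂ S) (hψ : ψ ∈ atlas ℂ S) {w : ℂ} (hw : w ∈ φ.target)
    (hw' : φ.symm w ∈ ψ.source) :
    g.density φ w = g.density ψ (ψ (φ.symm w)) * ‖deriv (fun x ↦ ψ (φ.symm x)) w‖ ^ 2 := by
  have h1 := g.normDerivSq_eq hψ (f := φ.symm) (φ.continuousAt_symm hw) hw'
    ((contDiffAt_transition hφ hψ hw hw').differentiableAt (by simp))
  rw [← h1, density_eq g hφ hw, normDerivSq]

end KahlerMetric

theorem hasFDerivAt_log_norm_sq {k : ℂ → ℂ} {w : ℂ} (hk : DifferentiableAt ℂ k w) (h0 : k w ≠ 0) :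
    HasFDerivAt (fun x ↦ Real.log (‖k x‖ ^ 2))
      ((2 : ℝ) • (Complex.reCLM.comp
        ((deriv k w / k w) • (1 : ℂ →L[ℝ] ℂ)))) w := by
  have h1 : HasFDerivAt k (deriv k w • (1 : ℂ →L[ℝ] ℂ)) w := hk.hasDerivAt.complexToReal_fderiv
  refine ((h1.norm_sq).log (by positivity)).congr_fderiv ?_
  have h3 : Complex.normSq (k w) ≠ 0 := by simpa using h0
  ext u
  simp [Complex.inner, ← Complex.normSq_eq_norm_sq, Complex.div_re, Complex.div_im]
  field_simp
  ring

namespace KahlerMetric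
variable {S : Type*} [TopologicalSpace S] [ChartedSpace ℂ S] [IsManifold 𝓘(ℂ) ω S]

theorem contDiffOn_logDensity (g : KahlerMetric S) {φ : OpenPartialHomeomorph S ℂ}
    (hφ : φ ∈ atlas ℂ S) : ContDiffOn ℝ ∞ (g.logDensity φ) φ.target :=
  (g.contDiffOn_density hφ).log fun _ hx ↦ (g.density_pos hφ hx).ne'

theorem contDiffAt_logDensity (g : KahlerMetric S) {φ : OpenPartialHomeomorph S ℂ}
    (hφ : φ ∈ atlas ℂ S) {w : ℂ} (hw : w ∈ φ.target) : ContDiffAt ℝ ∞ (g.logDensity φ) w :=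
  (g.contDiffOn_logDensity hφ).contDiffAt (φ.open_target.mem_nhds hw)

theorem fderiv_logDensity (g : KahlerMetric S) (φ : OpenPartialHomeomorph S ℂ) (w u : ℂ) :
    fderiv ℝ (g.logDensity φ) w u = 2 * (g.christoffel φ w * u).re := by
  conv_lhs => rw [← Complex.re_add_im u, mul_comm (u.im : ℂ), map_add]
  have h1 : ((u.re : ℝ) : ℂ) = u.re • (1 : ℂ) := by simp
  have h2 : Complex.I * ((u.im : ℝ) : ℂ) = u.im • Complex.I := by
    rw [Complex.real_smul, mul_comm]
  rw [h1, h2, map_smul, map_smul, christoffel]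
  simp
  ring

theorem christoffel_transition (g : KahlerMetric S) {φ ψ : OpenPartialHomeomorph S ℂ}
    (hφ : φ ∈ atlas ℂ S) (hψ : ψ ∈ atlas ℂ S) {w : ℂ} (hw : w ∈ φ.target)
    (hw' : φ.symm w ∈ ψ.source) :
    g.christoffel φ w = g.christoffel ψ (ψ (φ.symm w)) * deriv (fun x ↦ ψ (φ.symm x)) w +
      deriv (deriv (fun x ↦ ψ (φ.symm x))) w / deriv (fun x ↦ ψ (φ.symm x)) w := by
  set h : ℂ → ℂ := fun x ↦ ψ (φ.symm x) with hh
  have hd : ContDiffAt ℂ ω h w := contDiffAt_transition hφ hψ hw hw'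
  have h1 : g.logDensity φ =ᶠ[nhds w]
      fun x ↦ g.logDensity ψ (h x) + Real.log (‖deriv h x‖ ^ 2) := by
    filter_upwards [φ.open_target.mem_nhds hw,
      φ.continuousAt_symm hw (ψ.open_source.mem_nhds hw')] with x hx hx'
    rw [logDensity, density_transition g hφ hψ hx hx', Real.log_mul, logDensity]
    · exact (g.density_pos hψ (ψ.map_source hx')).ne'
    · exact pow_ne_zero _ (norm_ne_zero_iff.2 (deriv_transition_ne_zero hφ hψ hx hx'))
  have h2 : HasFDerivAt h (deriv h w • (1 : ℂ →L[ℝ] ℂ)) w :=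
    (hd.differentiableAt (by simp)).hasDerivAt.complexToReal_fderiv
  have h3 : DifferentiableAt ℂ (deriv h) w := by
    exact hd.analyticAt.deriv.differentiableAt
  have h4 := hasFDerivAt_log_norm_sq h3 (deriv_transition_ne_zero hφ hψ hw hw')
  have h5 := ((g.contDiffAt_logDensity hψ (ψ.map_source hw')).differentiableAt
    (by simp)).hasFDerivAt.comp w h2
  have h6 := ((h5.add h4).congr_of_eventuallyEq h1).fderiv
  have key : ∀ u : ℂ, (g.christoffel φ w * u).re = ((g.christoffel ψ (h w) * deriv h w +
      deriv (deriv h) w / deriv h w) * u).re := by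
    intro u
    have h7 := congrArg (fun L : ℂ →L[ℝ] ℝ ↦ L u) h6
    simp only [fderiv_logDensity, add_apply, ContinuousLinearMap.comp_apply, smul_apply] at h7
    simp at h7
    simp [add_mul]
    linarith
  have k1 := key 1
  have k2 := key Complex.I
  apply Complex.ext
  · simpa using k1
  · simp only [Complex.mul_I_re, neg_inj] at k2
    exact k2

theorem contDiffAt_chart_curve {c : ℝ → S} (hc : ContMDiff 𝓘(ℝ) 𝓘(ℝ, ℂ) ∞ c)
    {φ : OpenPartialHomeomorph S ℂ} (hφ : φ ∈ atlas ℂ S) {t : ℝ} (ht : c t ∈ φ.source) :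
    ContDiffAt ℝ ∞ (fun s ↦ φ (c s)) t := by
  have h1 : ContMDiffAt 𝓘(ℝ, ℂ) 𝓘(ℝ, ℂ) ∞ φ (c t) :=
    contMDiffAt_of_mem_maximalAtlas (IsManifold.subset_maximalAtlas hφ) ht
  exact contMDiffAt_iff_contDiffAt.1 (h1.comp t hc.contMDiffAt)

theorem IsGeodesic.deriv_deriv {g : KahlerMetric S} {c : ℝ → S} (hc : g.IsGeodesic c)
    {φ : OpenPartialHomeomorph S ℂ} (hφ : φ ∈ atlas ℂ S) {t : ℝ} (ht : c t ∈ φ.source) :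
    deriv (deriv fun s ↦ φ (c s)) t +
      g.christoffel φ (φ (c t)) * (deriv (fun s ↦ φ (c s)) t) ^ 2 = 0 := by
  set ψ := chartAt ℂ (c t) with hψ
  have hψa : ψ ∈ atlas ℂ S := chart_mem_atlas ℂ _
  have hcont : ContinuousAt c t := hc.1.continuous.continuousAt
  set v : ℝ → ℂ := fun s ↦ ψ (c s) with hv
  set h : ℂ → ℂ := fun x ↦ φ (ψ.symm x) with hh
  have hvt : v t ∈ ψ.target := ψ.map_source (mem_chart_source _ _)
  have hvt' : ψ.symm (v t) = c t := ψ.left_inv (mem_chart_source _ _)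
  have hvs : ContDiffAt ℝ ∞ v t := contDiffAt_chart_curve hc.1 hψa (mem_chart_source _ _)
  have hha : AnalyticAt ℂ h (v t) :=
    (contDiffAt_transition hψa hφ hvt (by rwa [hvt'])).analyticAt
  have hne : deriv h (v t) ≠ 0 := deriv_transition_ne_zero hψa hφ hvt (by rwa [hvt'])
  have h1 : (fun s ↦ φ (c s)) =ᶠ[nhds t] fun s ↦ h (v s) := by
    filter_upwards [hcont (ψ.open_source.mem_nhds (mem_chart_source _ _))] with s hs
    simp [hh, hv, ψ.left_inv hs]
  have h2 : deriv (fun s ↦ φ (c s)) =ᶠ[nhds t] fun s ↦ deriv h (v s) * deriv v s := by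
    filter_upwards [h1.eventuallyEq_nhds, hvs.continuousAt.eventually hha.eventually_analyticAt,
      hcont (ψ.open_source.mem_nhds (mem_chart_source _ _))] with s hs hs' hs''
    rw [hs.deriv_eq]
    exact (hs'.differentiableAt.hasDerivAt.comp_of_eq s
      ((contDiffAt_chart_curve hc.1 hψa hs'').differentiableAt
        (by simp)).hasDerivAt rfl).deriv
  have hd1 : HasDerivAt v (deriv v t) t := (hvs.differentiableAt (by simp)).hasDerivAt
  have hd2 : HasDerivAt (deriv v) (deriv (deriv v) t) t := by
    have : ContDiffAt ℝ ∞ (deriv v) t := hvs.derivWithin (by simp)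
    exact (this.differentiableAt (by simp)).hasDerivAt
  have hd3 : HasDerivAt (fun s ↦ deriv h (v s)) (deriv (deriv h) (v t) * deriv v t) t :=
    hha.deriv.differentiableAt.hasDerivAt.comp_of_eq t hd1 rfl
  have h3 := hc.2 t
  have h4 := christoffel_transition g hψa hφ hvt (by rwa [hvt'])
  rw [hvt'] at h4
  change deriv (deriv v) t + g.christoffel ψ (v t) * (deriv v t) ^ 2 = 0 at h3
  rw [h4] at h3
  rw [h2.deriv_eq, h2.eq_of_nhds, (hd3.fun_mul hd2).deriv]
  change deriv (deriv v) t + (g.christoffel φ (φ (c t)) * deriv h (v t) +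
    deriv (deriv h) (v t) / deriv h (v t)) * (deriv v t) ^ 2 = 0 at h3
  have h5 := congrArg (fun x ↦ deriv h (v t) * x) h3
  simp only [mul_zero] at h5
  rw [← h5]
  field_simp
  ring

/-- The speed of a geodesic is constant. -/
theorem IsGeodesic.hasDerivAt_speed {g : KahlerMetric S} {c : ℝ → S} (hc : g.IsGeodesic c)
    {φ : OpenPartialHomeomorph S ℂ} (hφ : φ ∈ atlas ℂ S) {t : ℝ} (ht : c t ∈ φ.source) :
    HasDerivAt (fun s ↦ Real.exp (g.logDensity φ (φ (c s))) *
      ‖deriv (fun s ↦ φ (c s)) s‖ ^ 2) 0 t := by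
  set w : ℝ → ℂ := fun s ↦ φ (c s) with hw
  have hws : ContDiffAt ℝ ∞ w t := contDiffAt_chart_curve hc.1 hφ ht
  have hd1 : HasDerivAt w (deriv w t) t := (hws.differentiableAt (by simp)).hasDerivAt
  have hd2 : HasDerivAt (deriv w) (deriv (deriv w) t) t := by
    have : ContDiffAt ℝ ∞ (deriv w) t := hws.derivWithin (by simp)
    exact (this.differentiableAt (by simp)).hasDerivAt
  have hl := ((g.contDiffAt_logDensity hφ (φ.map_source ht)).differentiableAt
    (by simp)).hasFDerivAt.comp_hasDerivAt_of_eq t hd1 rfl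
  rw [fderiv_logDensity] at hl
  refine (hl.exp.fun_mul hd2.norm_sq).congr_deriv ?_
  have h3 : deriv (deriv w) t = -(g.christoffel φ (w t) * (deriv w t) ^ 2) :=
    eq_neg_of_add_eq_zero_left (hc.deriv_deriv hφ ht)
  rw [h3, ← Complex.normSq_eq_norm_sq]
  simp [Complex.inner, Complex.normSq_apply, pow_two]
  ring

theorem IsGeodesic.exists_eqOn_ball {g : KahlerMetric S} {c : ℝ → S} (hc : g.IsGeodesic c)
    {φ : OpenPartialHomeomorph S ℂ} (hφ : φ ∈ atlas ℂ S) {t : ℝ} (ht : c t ∈ φ.source) :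
    ∃ r > 0, ∀ s ∈ ball t r, deriv (fun s ↦ φ (c s)) s = 0 → ∀ s' ∈ ball t r, c s' = c s := by
  obtain ⟨r, hr, hball⟩ := Metric.mem_nhds_iff.1
    (hc.1.continuous.continuousAt (x := t) (φ.open_source.mem_nhds ht))
  refine ⟨r, hr, fun s hs h0 s' hs' ↦ ?_⟩
  have hconv := convex_ball t r
  have h1 : ∀ x ∈ ball t r, deriv (fun s ↦ φ (c s)) x = 0 := by
    intro x hx
    have := isOpen_ball.is_const_of_deriv_eq_zero hconv.isPreconnected
      (fun y hy ↦ (hc.hasDerivAt_speed hφ (hball hy)).differentiableAt.differentiableWithinAt)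
      (fun y hy ↦ (hc.hasDerivAt_speed hφ (hball hy)).deriv) hx hs
    simpa [h0, Real.exp_ne_zero] using this
  have h2 := isOpen_ball.is_const_of_deriv_eq_zero hconv.isPreconnected
    (fun y hy ↦ ((contDiffAt_chart_curve hc.1 hφ (hball hy)).differentiableAt
      (by simp)).differentiableWithinAt) h1 hs' hs
  exact φ.injOn (hball hs') (hball hs) h2

theorem IsClosedGeodesic.deriv_ne_zero {g : KahlerMetric S} {γ : UnitAddCircle → S}
    (hγ : g.IsClosedGeodesic γ) {φ : OpenPartialHomeomorph S ℂ} (hφ : φ ∈ atlas ℂ S) {t : ℝ}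
    (ht : γ t ∈ φ.source) : deriv (fun s : ℝ ↦ φ (γ s)) t ≠ 0 := by
  intro h0
  set c : ℝ → S := fun s ↦ γ s with hcdef
  have hc : g.IsGeodesic c := hγ.1
  have key : IsClopen {s | c =ᶠ[nhds s] fun _ ↦ c t} := by
    constructor
    · rw [← closure_subset_iff_isClosed]
      intro x hx
      obtain ⟨r, hr, hball⟩ := hc.exists_eqOn_ball (chart_mem_atlas ℂ (c x))
        (mem_chart_source _ _)
      obtain ⟨b, hb, hbx⟩ := Metric.mem_closure_iff.1 hx r hr
      have h1 : deriv (fun s ↦ chartAt ℂ (c x) (c s)) b = 0 := by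
        have : (fun s ↦ chartAt ℂ (c x) (c s)) =ᶠ[nhds b] fun _ ↦ chartAt ℂ (c x) (c t) := by
          filter_upwards [hb] with s hs
          rw [hs]
        rw [this.deriv_eq, deriv_const]
      filter_upwards [ball_mem_nhds x hr] with s hs
      rw [hball b (by rwa [mem_ball, dist_comm]) h1 s hs]
      exact Filter.EventuallyEq.eq_of_nhds hb
    · exact isOpen_iff_mem_nhds.2 fun x hx ↦ hx.eventuallyEq_nhds
  obtain ⟨r, hr, hball⟩ := hc.exists_eqOn_ball hφ ht
  have hne : {s | c =ᶠ[nhds s] fun _ ↦ c t}.Nonempty := by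
    refine ⟨t, ?_⟩
    filter_upwards [ball_mem_nhds t hr] with s hs
    exact hball t (mem_ball_self hr) h0 s hs
  have huniv := key.eq_univ hne
  have hall : ∀ s, c s = c t := fun s ↦
    Filter.EventuallyEq.eq_of_nhds (huniv ▸ mem_univ s : s ∈ {s | c =ᶠ[nhds s] fun _ ↦ c t})
  obtain ⟨x, y, hxy⟩ := hγ.2
  obtain ⟨x, rfl⟩ := QuotientAddGroup.mk_surjective x
  obtain ⟨y, rfl⟩ := QuotientAddGroup.mk_surjective y
  exact hxy ((hall x).trans (hall y).symm)

end KahlerMetric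

theorem IsLocalMax.second_deriv_nonpos {g : ℝ → ℝ} {x a : ℝ} (h : IsLocalMax g x)
    (hc : ContinuousAt g x) (ha : HasDerivAt (deriv g) a x) : a ≤ 0 := by
  by_contra! hpos
  have h1 : IsLocalMin g x :=
    isLocalMin_of_deriv_deriv_pos (by rwa [ha.deriv]) h.deriv_eq_zero hc
  have h2 : g =ᶠ[nhds x] fun _ ↦ g x := by
    filter_upwards [h, h1] with y hy hy' using le_antisymm hy hy'
  have h3 : deriv g =ᶠ[nhds x] fun _ ↦ 0 := by
    filter_upwards [h2.eventuallyEq_nhds] with y hy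
    rw [hy.deriv_eq, deriv_const]
  rw [← ha.deriv, h3.deriv_eq, deriv_const] at hpos
  exact lt_irrefl _ hpos

/-- The function `σ ∘ v + log |v'|² + ε |z|²` is strictly subharmonic when `σ` is subharmonic and
`v` is holomorphic. -/
theorem not_isLocalMax_of_laplacian_nonneg {σ : ℂ → ℝ} {v : ℂ → ℂ} {z : ℂ} {ε : ℝ} (hε : 0 < ε)
    (hσ : ContDiffAt ℝ 2 σ (v z)) (hΔ : 0 ≤ Laplacian.laplacian σ (v z)) (hv : AnalyticAt ℂ v z)
    (hne : deriv v z ≠ 0) :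
    ¬ IsLocalMax (fun x ↦ σ (v x) + Real.log (‖deriv v x‖ ^ 2) + ε * ‖x‖ ^ 2) z := by
  intro hmax
  set Φ : ℂ → ℝ := fun x ↦ σ (v x) + Real.log (‖deriv v x‖ ^ 2) + ε * ‖x‖ ^ 2 with hΦ
  set q : ℂ → ℂ := fun x ↦ deriv (deriv v) x / deriv v x with hq
  have hqd : DifferentiableAt ℂ q z := (hv.deriv.deriv.div hv.deriv hne).differentiableAt
  have hcont : ContinuousAt (deriv v) z := hv.deriv.continuousAt
  set D : ℂ → ℂ → ℝ := fun e x ↦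
    fderiv ℝ σ (v x) (deriv v x * e) + 2 * (q x * e).re + ε * (2 * (x * starRingEnd ℂ e).re) with hD
  have h1 : ∀ᶠ x in nhds z, ∀ e : ℂ, ∀ l : ℝ → ℂ, ∀ t : ℝ, l t = x → HasDerivAt l e t →
      HasDerivAt (fun s ↦ Φ (l s)) (D e x) t := by
    filter_upwards [hv.eventually_analyticAt, hv.continuousAt.eventually (hσ.eventually (by simp)),
      hcont.eventually_ne hne] with x hx hσx hnex e l t hlt hl
    have a1 : HasDerivAt (fun s ↦ v (l s)) (deriv v x * e) t :=
      hx.differentiableAt.hasDerivAt.comp_of_eq t hl hlt.symm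
    have a2 : HasDerivAt (fun s ↦ σ (v (l s))) (fderiv ℝ σ (v x) (deriv v x * e)) t :=
      (hσx.differentiableAt (by simp)).hasFDerivAt.comp_hasDerivAt_of_eq t a1 (by rw [hlt])
    have a3 := (hasFDerivAt_log_norm_sq hx.deriv.differentiableAt hnex).comp_hasDerivAt_of_eq t hl
      hlt.symm
    refine ((a2.add a3).add ((hl.norm_sq).const_mul ε)).congr_deriv ?_
    rw [hD, hq, hlt]
    simp only [Complex.inner]
    simp
    left; ring
  have h2 : ∀ e : ℂ, fderiv ℝ (fderiv ℝ σ) (v z) (deriv v z * e) (deriv v z * e) +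
      fderiv ℝ σ (v z) (deriv (deriv v) z * e * e) + 2 * (deriv q z * e * e).re +
      ε * (2 * (e * starRingEnd ℂ e).re) ≤ 0 := by
    intro e
    set l : ℝ → ℂ := fun t ↦ z + t * e with hl
    have hl0 : l 0 = z := by simp [hl]
    have hld : ∀ t, HasDerivAt l e t := fun t ↦ by
      have := (((Complex.ofRealCLM.hasDerivAt (x := t)).mul_const e).const_add z)
      rwa [Complex.ofRealCLM_apply, Complex.ofReal_one, one_mul] at this
    have hlc : Filter.Tendsto l (nhds 0) (nhds z) := by
      have := (hld 0).continuousAt; rwa [ContinuousAt, hl0] at this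
    have b0 : deriv (fun s ↦ Φ (l s)) =ᶠ[nhds 0] fun s ↦ D e (l s) := by
      filter_upwards [hlc.eventually h1] with t ht using (ht e l t rfl (hld t)).deriv
    have b1 : HasDerivAt (fun s ↦ v (l s)) (deriv v z * e) 0 :=
      hv.differentiableAt.hasDerivAt.comp_of_eq 0 (hld 0) hl0.symm
    have b2 : HasDerivAt (fun s ↦ deriv v (l s)) (deriv (deriv v) z * e) 0 :=
      hv.deriv.differentiableAt.hasDerivAt.comp_of_eq 0 (hld 0) hl0.symm
    have b3 : HasDerivAt (fun s ↦ q (l s)) (deriv q z * e) 0 :=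
      hqd.hasDerivAt.comp_of_eq 0 (hld 0) hl0.symm
    have b4 : HasDerivAt (fun s ↦ fderiv ℝ σ (v (l s)))
        (fderiv ℝ (fderiv ℝ σ) (v z) (deriv v z * e)) 0 := by
      have : DifferentiableAt ℝ (fderiv ℝ σ) (v z) :=
        (hσ.fderiv_right (m := 1) (by norm_num)).differentiableAt (by simp)
      exact this.hasFDerivAt.comp_hasDerivAt_of_eq 0 b1 (by rw [hl0])
    have b5 := b4.clm_apply (b2.mul_const e)
    have b6 := (Complex.reCLM.hasFDerivAt.comp_hasDerivAt (0 : ℝ) (b3.mul_const e)).const_mul 2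
    have b7 := ((Complex.reCLM.hasFDerivAt.comp_hasDerivAt (0 : ℝ)
      ((hld 0).mul_const (starRingEnd ℂ e))).const_mul 2).const_mul ε
    have b8 := (b5.add b6).add b7
    rw [hl0] at b8
    have b9 : HasDerivAt (deriv fun s ↦ Φ (l s)) _ 0 := b8.congr_of_eventuallyEq b0
    refine IsLocalMax.second_deriv_nonpos (x := 0) (g := fun s ↦ Φ (l s)) ?_
      (h1.self_of_nhds e l 0 hl0 (hld 0)).continuousAt (b9.congr_deriv ?_)
    · have := hlc.eventually hmax
      simpa only [IsLocalMax, IsMaxFilter, hl0] using this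
    · simp
  have h3 := h2 1
  have h4 := h2 Complex.I
  have h5 : 0 ≤ fderiv ℝ (fderiv ℝ σ) (v z) 1 1 +
      fderiv ℝ (fderiv ℝ σ) (v z) Complex.I Complex.I := by
    simpa [InnerProductSpace.laplacian_eq_iteratedFDeriv_complexPlane,
      iteratedFDeriv_two_apply] using hΔ
  have h6 : deriv (deriv v) z * Complex.I * Complex.I = -deriv (deriv v) z := by
    rw [mul_assoc, Complex.I_mul_I]; ring
  have h7 : deriv q z * Complex.I * Complex.I = -deriv q z := by
    rw [mul_assoc, Complex.I_mul_I]; ring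
  rw [h6, h7] at h4
  simp only [mul_one, map_neg, Complex.neg_re, Complex.conj_I, mul_neg, Complex.I_mul_I, neg_neg,
    Complex.one_re, map_one] at h3 h4
  set B := fderiv ℝ (fderiv ℝ σ) (v z) with hB
  set p := deriv v z with hp
  have e1 : p = p.re • (1 : ℂ) + p.im • Complex.I := by
    apply Complex.ext <;> simp
  have e2 : p * Complex.I = p.re • Complex.I - p.im • (1 : ℂ) := by
    apply Complex.ext <;> simp
  have h8 : B p p + B (p * Complex.I) (p * Complex.I) =
      (p.re ^ 2 + p.im ^ 2) * (B 1 1 + B Complex.I Complex.I) := by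
    rw [e2]
    nth_rewrite 1 2 [e1]
    simp only [map_add, map_sub, map_smul, add_apply, sub_apply, smul_apply, smul_eq_mul]
    ring
  have h9 : 0 ≤ (p.re ^ 2 + p.im ^ 2) * (B 1 1 + B Complex.I Complex.I) := by positivity
  linarith

namespace KahlerMetric
variable {S : Type*} [TopologicalSpace S] [ChartedSpace ℂ S] [IsManifold 𝓘(ℂ) ω S]

theorem differentiableAt_chart_comp {f : ℂ → S} {z : ℂ} (hf : MDifferentiableAt 𝓘(ℂ) 𝓘(ℂ) f z)
    {φ : OpenPartialHomeomorph S ℂ} (hφ : φ ∈ atlas ℂ S) (hz : f z ∈ φ.source) :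
    DifferentiableAt ℂ (fun x ↦ φ (f x)) z := by
  have h1 : MDifferentiableAt 𝓘(ℂ) 𝓘(ℂ) φ (f z) :=
    haveI : IsManifold 𝓘(ℂ) 1 S := .of_le (n := ω) (by simp)
    mdifferentiableAt_atlas hφ hz
  exact mdifferentiableAt_iff_differentiableAt.1 (h1.comp z hf)

section Disc

variable {f : ℂ → S} {U : Set ℂ}

theorem analyticAt_chart_comp (hU : IsOpen U) (hf : MDifferentiableOn 𝓘(ℂ) 𝓘(ℂ) f U) {z : ℂ}
    (hzU : z ∈ U) {φ : OpenPartialHomeomorph S ℂ} (hφ : φ ∈ atlas ℂ S) (hz : f z ∈ φ.source) :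
    AnalyticAt ℂ (fun x ↦ φ (f x)) z := by
  rw [Complex.analyticAt_iff_eventually_differentiableAt]
  filter_upwards [hU.mem_nhds hzU,
    (hf.mdifferentiableAt (hU.mem_nhds hzU)).continuousAt (φ.open_source.mem_nhds hz)] with x hx hx'
  exact differentiableAt_chart_comp (hf.mdifferentiableAt (hU.mem_nhds hx)) hφ hx'

theorem normDerivSq_eventuallyEq (g : KahlerMetric S) (hU : IsOpen U)
    (hf : MDifferentiableOn 𝓘(ℂ) 𝓘(ℂ) f U) {z : ℂ}
    (hzU : z ∈ U) {φ : OpenPartialHomeomorph S ℂ} (hφ : φ ∈ atlas ℂ S) (hz : f z ∈ φ.source) :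
    g.normDerivSq f =ᶠ[nhds z]
      fun x ↦ g.density φ (φ (f x)) * ‖deriv (fun x ↦ φ (f x)) x‖ ^ 2 := by
  filter_upwards [hU.mem_nhds hzU,
    (hf.mdifferentiableAt (hU.mem_nhds hzU)).continuousAt (φ.open_source.mem_nhds hz)] with x hx hx'
  have := hf.mdifferentiableAt (hU.mem_nhds hx)
  exact g.normDerivSq_eq hφ this.continuousAt hx' (differentiableAt_chart_comp this hφ hx')

theorem continuousOn_normDerivSq (g : KahlerMetric S) (hU : IsOpen U)
    (hf : MDifferentiableOn 𝓘(ℂ) 𝓘(ℂ) f U) : ContinuousOn (g.normDerivSq f) U := by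
  intro z hz
  have hs := mem_chart_source ℂ (f z)
  have ha := analyticAt_chart_comp hU hf hz (chart_mem_atlas ℂ (f z)) hs
  have hd : ContinuousAt (g.density (chartAt ℂ (f z))) (chartAt ℂ (f z) (f z)) :=
    (g.contDiffOn_density (chart_mem_atlas ℂ _)).continuousOn.continuousAt
      ((chartAt ℂ (f z)).open_target.mem_nhds (mem_chart_target _ _))
  refine (ContinuousAt.congr ?_
    (g.normDerivSq_eventuallyEq hU hf hz (chart_mem_atlas ℂ _) hs).symm).continuousWithinAt
  exact (ContinuousAt.comp_of_eq hd ha.continuousAt rfl).mul (ha.deriv.continuousAt.norm.pow 2)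

/-- The maximum principle for the derivative of a holomorphic map into a nonpositively curved
surface. -/
theorem normDerivSq_le_of_sphere (g : KahlerMetric S) (hg : ∀ p, g.scalarCurvature p ≤ 0)
    (hU : IsOpen U) (hf : MDifferentiableOn 𝓘(ℂ) 𝓘(ℂ) f U) {R Λ : ℝ} (hΛ : 0 ≤ Λ)
    (hRU : closedBall 0 R ⊆ U) (hR : ∀ z ∈ sphere (0 : ℂ) R, g.normDerivSq f z ≤ Λ) {z : ℂ}
    (hz : z ∈ closedBall 0 R) : g.normDerivSq f z ≤ Λ := by
  by_contra! hlt
  obtain ⟨ε, hε, hεz⟩ : ∃ ε > 0, Λ * Real.exp (ε * R ^ 2) < g.normDerivSq f z := by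
    have h1 : Filter.Tendsto (fun ε : ℝ ↦ Λ * Real.exp (ε * R ^ 2)) (nhdsWithin 0 (Ioi 0))
        (nhds (Λ * Real.exp (0 * R ^ 2))) :=
      (Continuous.tendsto (by fun_prop) 0).mono_left nhdsWithin_le_nhds
    rw [zero_mul, Real.exp_zero, mul_one] at h1
    obtain ⟨ε, h2, h3⟩ := ((h1.eventually_lt_const hlt).and self_mem_nhdsWithin).exists
    exact ⟨ε, h3, h2⟩
  set Φ : ℂ → ℝ := fun x ↦ g.normDerivSq f x * Real.exp (ε * ‖x‖ ^ 2) with hΦ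
  have hΦc : ContinuousOn Φ (closedBall 0 R) :=
    ((g.continuousOn_normDerivSq hU hf).mono hRU).mul (by fun_prop)
  obtain ⟨x, hx, hmax⟩ := (isCompact_closedBall (0 : ℂ) R).exists_isMaxOn ⟨z, hz⟩ hΦc
  have h0z : 0 ≤ g.normDerivSq f z := hΛ.trans hlt.le
  have h1 : Λ * Real.exp (ε * R ^ 2) < Φ x := by
    refine lt_of_lt_of_le hεz (le_trans ?_ (hmax hz))
    exact le_mul_of_one_le_right h0z (Real.one_le_exp (by positivity))
  have hxb : x ∈ ball 0 R := by
    rcases (mem_closedBall_zero_iff.1 hx).lt_or_eq with h | h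
    · exact mem_ball_zero_iff.2 h
    · exfalso
      have := hR x (mem_sphere_zero_iff_norm.2 h)
      rw [hΦ] at h1
      simp only [h] at h1
      exact absurd h1 (not_lt.2 (by gcongr))
  have hloc : IsLocalMax Φ x :=
    (hmax.on_subset ball_subset_closedBall).isLocalMax (isOpen_ball.mem_nhds hxb)
  have hxU := hRU hx
  have hs := mem_chart_source ℂ (f x)
  have hat := chart_mem_atlas ℂ (f x)
  set φ := chartAt ℂ (f x) with hφ
  have ha := analyticAt_chart_comp hU hf hxU hat hs
  set v : ℂ → ℂ := fun y ↦ φ (f y) with hv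
  have hev := g.normDerivSq_eventuallyEq hU hf hxU hat hs
  have hpos : 0 < Φ x := lt_of_le_of_lt (by positivity) h1
  have hne : deriv v x ≠ 0 := by
    intro h
    rw [hΦ] at hpos
    simp only [hev.eq_of_nhds, ← hv, h] at hpos
    simp at hpos
  have hdens := g.density_pos hat (φ.map_source hs)
  have hΔ : 0 ≤ Laplacian.laplacian (g.logDensity φ) (v x) := by
    have h2 := hg (f x)
    rw [scalarCurvature, ← hφ, neg_nonpos, div_nonneg_iff] at h2
    rcases h2 with h2 | h2
    · exact h2.1
    · exact absurd h2.2 (not_le.2 hdens)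
  refine not_isLocalMax_of_laplacian_nonneg hε
    (mod_cast contDiffAt_infty.1 (g.contDiffAt_logDensity hat (φ.map_source hs)) 2) hΔ ha hne ?_
  have h3 : (fun y ↦ g.logDensity φ (v y) + Real.log (‖deriv v y‖ ^ 2) + ε * ‖y‖ ^ 2) =ᶠ[nhds x]
      fun y ↦ Real.log (Φ y) := by
    filter_upwards [hev, ha.deriv.continuousAt.eventually_ne hne,
      ha.continuousAt.eventually (φ.open_target.mem_nhds (φ.map_source hs))] with y h4 h5 h6
    have h7 := (g.density_pos hat h6).ne'
    rw [hΦ]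
    simp only [h4]
    rw [Real.log_mul (mul_ne_zero h7 (by positivity)) (Real.exp_pos _).ne', Real.log_exp,
      Real.log_mul h7 (by positivity), logDensity]
  have h8 : IsLocalMax (fun y ↦ Real.log (Φ y)) x := by
    have hΦx : ContinuousAt Φ x := hΦc.continuousAt (Filter.mem_of_superset
      (isOpen_ball.mem_nhds hxb) ball_subset_closedBall)
    filter_upwards [hloc, hΦx.eventually (lt_mem_nhds hpos)] with y h9 h10
    exact Real.log_le_log h10 h9
  exact h8.congr h3.symm

end Disc

end KahlerMetric

namespace Complex

theorem re_nonneg_of_forall_mem_frontier {A : ℂ → ℂ} {U : Set ℂ} (hU : Bornology.IsBounded U)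
    (hA : DiffContOnCl ℂ A U) (h : ∀ z ∈ frontier U, 0 ≤ (A z).re) {z : ℂ} (hz : z ∈ closure U) :
    0 ≤ (A z).re := by
  have h1 : DiffContOnCl ℂ (fun z ↦ exp (-A z)) U :=
    Complex.differentiable_exp.comp_diffContOnCl hA.neg
  have h2 := norm_le_of_forall_mem_frontier_norm_le hU h1 (C := 1)
    (fun w hw ↦ by simpa [norm_exp] using h w hw) hz
  simpa [norm_exp] using h2

/-- Schwarz's lemma for holomorphic functions with nonnegative real part. -/
theorem norm_deriv_mul_le_of_re_nonneg {A : ℂ → ℂ} {c : ℂ} {R : ℝ} (hR : 0 < R)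
    (hA : DifferentiableOn ℂ A (ball c R)) (h : ∀ z ∈ ball c R, 0 ≤ (A z).re) :
    ‖deriv A c‖ * R ≤ 2 * (A c).re := by
  have hc : c ∈ ball c R := mem_ball_self hR
  have hAc : DifferentiableAt ℂ A c := hA.differentiableAt (isOpen_ball.mem_nhds hc)
  refine le_of_forall_pos_le_add fun ε hε ↦ ?_
  set b : ℂ := A c + (ε / 2 : ℝ) with hb
  have hbre : 0 < b.re := by
    have := h c hc
    simp [hb]; linarith
  have hne : ∀ z ∈ ball c R, A z + (ε / 2 : ℝ) + starRingEnd ℂ b ≠ 0 := by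
    intro z hz h0
    have h1 := h z hz
    have h2 := congrArg re h0
    simp only [add_re, ofReal_re, conj_re, zero_re] at h2
    linarith
  set ψ : ℂ → ℂ := fun z ↦ (A z + (ε / 2 : ℝ) - b) / (A z + (ε / 2 : ℝ) + starRingEnd ℂ b) with hψ
  have hψd : DifferentiableOn ℂ ψ (ball c R) :=
    ((hA.add_const _).sub_const _).div ((hA.add_const _).add_const _) hne
  have hψc : ψ c = 0 := by simp [hψ, hb]
  have hmaps : MapsTo ψ (ball c R) (ball (ψ c) 1) := by
    intro z hz
    rw [hψc, mem_ball_zero_iff, hψ]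
    simp only [norm_div]
    rw [div_lt_one (norm_pos_iff.2 (hne z hz)), ← sq_lt_sq₀ (norm_nonneg _) (norm_nonneg _),
      ← normSq_eq_norm_sq, ← normSq_eq_norm_sq, normSq_apply, normSq_apply]
    have h1 := h z hz
    simp only [sub_re, add_re, ofReal_re, sub_im, add_im, ofReal_im, conj_re, conj_im]
    nlinarith [mul_pos (show 0 < (A z).re + ε / 2 by linarith) hbre]
  have h1 := norm_deriv_le_div_of_mapsTo_ball hψd (hmaps.mono_right ball_subset_closedBall) hR
  have h2 : deriv ψ c = deriv A c / (2 * b.re : ℝ) := by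
    have e1 : HasDerivAt (fun z ↦ A z + (ε / 2 : ℝ) - b) (deriv A c) c :=
      (hAc.hasDerivAt.add_const _).sub_const _
    have e2 : HasDerivAt (fun z ↦ A z + (ε / 2 : ℝ) + starRingEnd ℂ b) (deriv A c) c :=
      (hAc.hasDerivAt.add_const _).add_const _
    rw [hψ, (e1.fun_div e2 (hne c hc)).deriv, ← hb, sub_self, add_conj]
    have : ((2 * b.re : ℝ) : ℂ) ≠ 0 := by exact_mod_cast (by positivity)
    field_simp
    ring
  rw [h2, norm_div, norm_real, Real.norm_of_nonneg (by positivity),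
    div_le_div_iff₀ (by positivity) hR] at h1
  have h3 : b.re = (A c).re + ε / 2 := by simp [hb]
  rw [h3] at h1
  linarith

/-- The Schwarz-Pick inequality for functions with nonnegative real part in the disc with diameter
`[0, 2κ]`. -/
theorem norm_deriv_mul_le_of_re_nonneg_of_ball {A : ℂ → ℂ} {κ d : ℝ} (hd : 0 < d)
    (hdκ : d < 2 * κ) (hA : DifferentiableOn ℂ A (ball (κ : ℂ) κ))
    (h : ∀ z ∈ ball (κ : ℂ) κ, 0 ≤ (A z).re) :
    ‖deriv A d‖ * (d * (2 * κ - d)) ≤ 2 * κ * (A d).re := by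
  have hκ : 0 < κ := by linarith
  set e : ℝ := (d - κ) / κ with he
  have heκ : κ + κ * e = d := by rw [he]; field_simp; ring
  have he1 : e ^ 2 < 1 := by
    rw [he, sq_lt_one_iff_abs_lt_one, abs_lt]
    constructor
    · rw [lt_div_iff₀ hκ]; linarith
    · rw [div_lt_one hκ]; linarith
  set T : ℂ → ℂ := fun ξ ↦ κ + κ * ((ξ + e) / (1 + e * ξ)) with hT
  have hlt : ∀ ξ ∈ ball (0 : ℂ) 1, ‖ξ + e‖ < ‖1 + e * ξ‖ := by
    intro ξ hξ
    rw [mem_ball_zero_iff] at hξ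
    rw [← sq_lt_sq₀ (norm_nonneg _) (norm_nonneg _), ← normSq_eq_norm_sq, ← normSq_eq_norm_sq,
      normSq_apply, normSq_apply]
    have h1 : ξ.re ^ 2 + ξ.im ^ 2 < 1 := by
      rw [← sq_lt_one_iff₀ (norm_nonneg _), ← normSq_eq_norm_sq, normSq_apply] at hξ
      linarith
    simp
    nlinarith [mul_pos (sub_pos.2 h1) (sub_pos.2 he1)]
  have hne : ∀ ξ ∈ ball (0 : ℂ) 1, 1 + e * ξ ≠ 0 := fun ξ hξ h0 ↦ by
    have := hlt ξ hξ
    rw [h0, norm_zero] at this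
    exact absurd this (not_lt.2 (norm_nonneg _))
  have hTd : DifferentiableOn ℂ T (ball 0 1) := by
    refine (DifferentiableOn.const_mul (DifferentiableOn.div (by fun_prop) (by fun_prop) hne) _).const_add _
  have hTm : MapsTo T (ball 0 1) (ball (κ : ℂ) κ) := by
    intro ξ hξ
    rw [mem_ball_iff_norm, hT]
    simp only [add_sub_cancel_left, norm_mul, norm_div, norm_real, Real.norm_of_nonneg hκ.le]
    have := hlt ξ hξ
    have h2 : ‖ξ + e‖ / ‖1 + e * ξ‖ < 1 := (div_lt_one (norm_pos_iff.2 (hne ξ hξ))).2 this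
    nlinarith
  have hT0 : T 0 = d := by
    simp only [hT, zero_add, mul_zero, add_zero, div_one]
    exact_mod_cast heκ
  have h1 := norm_deriv_mul_le_of_re_nonneg one_pos (hA.comp hTd hTm) (fun ξ hξ ↦ h _ (hTm hξ))
  have hT' : HasDerivAt T (κ * (1 - e ^ 2) : ℝ) 0 := by
    have e1 : HasDerivAt (fun ξ : ℂ ↦ ξ + e) 1 0 := (hasDerivAt_id _).add_const _
    have e2 : HasDerivAt (fun ξ : ℂ ↦ 1 + e * ξ) (e * 1) 0 :=
      ((hasDerivAt_id _).const_mul _).const_add _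
    refine (((e1.fun_div e2 (by simp)).const_mul (κ : ℂ)).const_add (κ : ℂ)).congr_deriv ?_
    push_cast
    simp
    ring_nf
    tauto
  have hAd : DifferentiableAt ℂ A (T 0) :=
    hA.differentiableAt (isOpen_ball.mem_nhds (hTm (mem_ball_self one_pos)))
  have h2 := (hAd.hasDerivAt.comp 0 hT').deriv
  rw [h2, norm_mul, norm_real, Function.comp_apply, hT0, Real.norm_of_nonneg (by nlinarith)] at h1
  have h3 : κ * (κ * (1 - e ^ 2)) = d * (2 * κ - d) := by rw [← heκ]; ring
  rw [← h3]
  nlinarith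

end Complex

namespace Complex

theorem norm_sub_sq_le_two_mul_re {z z₀ : ℂ} (hz : ‖z‖ ≤ 1) (hz₀ : ‖z₀‖ = 1) :
    ‖z - z₀‖ ^ 2 ≤ 2 * (1 - z * starRingEnd ℂ z₀).re := by
  have h1 : ‖z‖ ^ 2 ≤ 1 := pow_le_one₀ (norm_nonneg _) hz
  have h2 : ‖z₀‖ ^ 2 = 1 := by rw [hz₀, one_pow]
  rw [← normSq_eq_norm_sq, normSq_apply] at *
  simp
  nlinarith

theorem re_one_sub_mul_conj_le {z z₀ : ℂ} (hz₀ : ‖z₀‖ = 1) :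
    (1 - z * starRingEnd ℂ z₀).re ≤ ‖z₀ - z‖ := by
  have h1 : 1 - z * starRingEnd ℂ z₀ = (z₀ - z) * starRingEnd ℂ z₀ := by
    rw [sub_mul, mul_conj, normSq_eq_norm_sq, hz₀]; simp
  calc _ ≤ ‖1 - z * starRingEnd ℂ z₀‖ := re_le_norm _
    _ = _ := by rw [h1, norm_mul, norm_conj, hz₀, mul_one]

/-- A linear barrier at a boundary point of the unit disc. -/
theorem re_le_of_re_nonpos_on_sphere {Ψ : ℂ → ℂ} {z₀ : ℂ} {δ M : ℝ} (hz₀ : ‖z₀‖ = 1) (hδ : 0 < δ)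
    (hM : 0 ≤ M) (hd : DifferentiableOn ℂ Ψ (ball 0 1 ∩ ball z₀ δ))
    (hc : ContinuousOn Ψ (closedBall 0 1 ∩ ball z₀ δ))
    (hb : ∀ z ∈ sphere (0 : ℂ) 1 ∩ ball z₀ δ, (Ψ z).re ≤ 0)
    (hM' : ∀ z ∈ closedBall (0 : ℂ) 1 ∩ ball z₀ δ, (Ψ z).re ≤ M)
    {z : ℂ} (hz : z ∈ ball (0 : ℂ) 1 ∩ ball z₀ (δ / 2)) :
    (Ψ z).re ≤ 8 * M / δ ^ 2 * (1 - z * starRingEnd ℂ z₀).re := by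
  set U : Set ℂ := ball 0 1 ∩ ball z₀ (δ / 2) with hU
  set C : ℝ := 8 * M / δ ^ 2 with hC
  have hC0 : 0 ≤ C := by positivity
  have hcl : closure U ⊆ closedBall 0 1 ∩ closedBall z₀ (δ / 2) :=
    (closure_inter_subset_inter_closure _ _).trans
      (inter_subset_inter closure_ball_subset_closedBall closure_ball_subset_closedBall)
  have hcb : closedBall z₀ (δ / 2) ⊆ ball z₀ δ := closedBall_subset_ball (by linarith)
  set A : ℂ → ℂ := fun z ↦ C * (1 - z * starRingEnd ℂ z₀) - Ψ z with hA
  have hre : ∀ z, (A z).re = C * (1 - z * starRingEnd ℂ z₀).re - (Ψ z).re := fun z ↦ by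
    simp only [hA, sub_re, re_ofReal_mul]
  have hAd : DiffContOnCl ℂ A U := by
    constructor
    · exact DifferentiableOn.sub (by fun_prop)
        (hd.mono (inter_subset_inter_right _ (ball_subset_ball (by linarith))))
    · exact ContinuousOn.sub (by fun_prop)
        (hc.mono (hcl.trans (inter_subset_inter_right _ hcb)))
  have h1 := re_nonneg_of_forall_mem_frontier (isBounded_ball.subset inter_subset_left) hAd
    (fun w hw ↦ ?_) (subset_closure hz)
  · rw [hre] at h1
    linarith
  · have hw1 := hcl hw.1
    have hwU : w ∉ U := by
      rw [frontier, (isOpen_ball.inter isOpen_ball).interior_eq] at hw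
      exact hw.2
    have h2 := norm_sub_sq_le_two_mul_re (mem_closedBall_zero_iff.1 hw1.1) hz₀
    have h3 : 0 ≤ (1 - w * starRingEnd ℂ z₀).re := by nlinarith [sq_nonneg ‖w - z₀‖]
    rw [hre, sub_nonneg]
    by_cases hw2 : w ∈ ball (0 : ℂ) 1
    · have h4 : δ / 2 ≤ ‖w - z₀‖ := by
        by_contra! h
        exact hwU ⟨hw2, mem_ball_iff_norm.2 h⟩
      refine (hM' w ⟨hw1.1, hcb hw1.2⟩).trans ?_
      have h5 : (δ / 2) ^ 2 ≤ ‖w - z₀‖ ^ 2 := by gcongr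
      have h6 : M = C * (δ ^ 2 / 8) := by rw [hC]; field_simp
      rw [h6]
      gcongr
      nlinarith
    · refine (hb w ⟨?_, hcb hw1.2⟩).trans (by positivity)
      rw [mem_sphere_zero_iff_norm]
      exact le_antisymm (mem_closedBall_zero_iff.1 hw1.1)
        (not_lt.1 fun h ↦ hw2 (mem_ball_zero_iff.2 h))

theorem norm_deriv_mul_le_of_re_nonpos_on_sphere {Ψ : ℂ → ℂ} {z z₀ : ℂ} {δ M : ℝ}
    (hz₀ : ‖z₀‖ = 1) (hδ : 0 < δ)
    (hM : 0 ≤ M) (hd : DifferentiableOn ℂ Ψ (ball 0 1 ∩ ball z₀ δ))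
    (hc : ContinuousOn Ψ (closedBall 0 1 ∩ ball z₀ δ))
    (hb : ∀ z ∈ sphere (0 : ℂ) 1 ∩ ball z₀ δ, (Ψ z).re ≤ 0)
    (hM' : ∀ z ∈ closedBall (0 : ℂ) 1 ∩ ball z₀ δ, (Ψ z).re ≤ M)
    (hz1 : ‖z‖ < 1) (hz : ‖z - z₀‖ = 1 - ‖z‖) (hzδ : 1 - ‖z‖ ≤ δ / 4) :
    (Ψ z).re ≤ 8 * M / δ ^ 2 * (1 - ‖z‖) ∧
      ‖deriv Ψ z‖ * (1 - ‖z‖) ≤ 2 * (2 * (8 * M / δ ^ 2) * (1 - ‖z‖) - (Ψ z).re) := by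
  set d := 1 - ‖z‖ with hdd
  have hd0 : 0 < d := by linarith
  set C : ℝ := 8 * M / δ ^ 2 with hC
  have hC0 : 0 ≤ C := by positivity
  have hsub : ball z d ⊆ ball (0 : ℂ) 1 ∩ ball z₀ (δ / 2) := by
    intro w hw
    rw [mem_ball_iff_norm] at hw
    constructor
    · rw [mem_ball_zero_iff]
      calc ‖w‖ = ‖(w - z) + z‖ := by ring_nf
        _ ≤ ‖w - z‖ + ‖z‖ := norm_add_le _ _
        _ < 1 := by linarith
    · rw [mem_ball_iff_norm]
      calc ‖w - z₀‖ = ‖(w - z) + (z - z₀)‖ := by ring_nf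
        _ ≤ ‖w - z‖ + ‖z - z₀‖ := norm_add_le _ _
        _ < δ / 2 := by linarith
  have hbar := fun w (hw : w ∈ ball (0 : ℂ) 1 ∩ ball z₀ (δ / 2)) ↦
    re_le_of_re_nonpos_on_sphere hz₀ hδ hM hd hc hb hM' hw
  constructor
  · refine (hbar z (hsub (mem_ball_self hd0))).trans ?_
    gcongr
    refine (re_one_sub_mul_conj_le hz₀).trans_eq ?_
    rw [norm_sub_rev, hz]
  · have hsub' : ball z d ⊆ ball (0 : ℂ) 1 ∩ ball z₀ δ :=
      hsub.trans (inter_subset_inter_right _ (ball_subset_ball (by linarith)))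
    have h1 := norm_deriv_mul_le_of_re_nonneg (A := fun w ↦ ((2 * C * d : ℝ) : ℂ) - Ψ w) hd0
      ((hd.mono hsub').const_sub _) (fun w hw ↦ ?_)
    · simpa using h1
    · simp only [sub_re, ofReal_re, sub_nonneg]
      refine (hbar w (hsub hw)).trans ?_
      have h2 : (1 - w * starRingEnd ℂ z₀).re ≤ 2 * d := by
        refine (re_one_sub_mul_conj_le hz₀).trans ?_
        calc ‖z₀ - w‖ = ‖(z₀ - z) + (z - w)‖ := by ring_nf
          _ ≤ ‖z₀ - z‖ + ‖z - w‖ := norm_add_le _ _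
          _ ≤ d + d := by
            rw [norm_sub_rev, hz, norm_sub_rev z]
            rw [mem_ball_iff_norm] at hw
            linarith
          _ = 2 * d := by ring
      calc C * _ ≤ C * (2 * d) := by gcongr
        _ = 2 * C * d := by ring

end Complex

theorem ContDiffAt.exists_taylor_two {E F : Type*} [NormedAddCommGroup E] [NormedSpace ℝ E]
    [NormedAddCommGroup F] [NormedSpace ℝ F] {f : E → F} {x₀ : E} (hf : ContDiffAt ℝ 2 f x₀) :
    ∃ K > 0, ∃ ε > 0, ∀ x ∈ ball x₀ ε, ∀ y ∈ ball x₀ ε,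
      ‖f y - f x - fderiv ℝ f x (y - x)‖ ≤ K * ‖y - x‖ ^ 2 := by
  have h1 : ContDiffAt ℝ 1 (fderiv ℝ f) x₀ := hf.fderiv_right (by norm_num)
  obtain ⟨K, t, ht, hK⟩ := h1.exists_lipschitzOnWith
  obtain ⟨ε, hε, hball⟩ := Metric.mem_nhds_iff.1
    (Filter.inter_mem ht (hf.eventually (by simp)))
  refine ⟨K + 1, by positivity, ε, hε, fun x hx y hy ↦ ?_⟩
  have hseg : segment ℝ x y ⊆ ball x₀ ε := (convex_ball x₀ ε).segment_subset hx hy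
  have h2 := (convex_segment (𝕜 := ℝ) x y).norm_image_sub_le_of_norm_fderiv_le'
    (fun z hz ↦ (show ContDiffAt ℝ 2 f z from (hball (hseg hz)).2).differentiableAt (by simp)) (φ := fderiv ℝ f x)
    (C := (K + 1) * ‖y - x‖) (fun z hz ↦ ?_) (left_mem_segment ℝ x y) (right_mem_segment ℝ x y)
  · rwa [mul_assoc, ← sq] at h2
  · refine (hK.norm_sub_le (hball (hseg hz)).1 (hball hx).1).trans ?_
    have := norm_sub_le_of_mem_segment hz
    gcongr
    linarith

theorem ContDiffAt.exists_taylor_two_real {c : ℝ → ℂ} {t₀ : ℝ} (hc : ContDiffAt ℝ 2 c t₀) :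
    ∃ K > 0, ∃ ε > 0, ∀ s ∈ ball t₀ ε, ∀ t ∈ ball t₀ ε,
      ‖c t - c s - (t - s) * deriv c s‖ ≤ K * |t - s| ^ 2 := by
  obtain ⟨K, hK, ε, hε, h⟩ := hc.exists_taylor_two
  refine ⟨K, hK, ε, hε, fun s hs t ht ↦ ?_⟩
  simpa [fderiv_eq_smul_deriv] using h s hs t ht

theorem ContDiffAt.exists_taylor_three_real {c : ℝ → ℂ} {t₀ : ℝ} (hc : ContDiffAt ℝ 3 c t₀) :
    ∃ K > 0, ∃ ε > 0, ∀ s ∈ ball t₀ ε, ∀ t ∈ ball t₀ ε,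
      ‖c t - c s - (t - s) * deriv c s - (t - s) ^ 2 / 2 * deriv (deriv c) s‖ ≤
        K * |t - s| ^ 3 := by
  have h1 : ContDiffAt ℝ 2 (deriv c) t₀ := hc.derivWithin (by norm_num)
  obtain ⟨K, hK, ε, hε, h⟩ := h1.exists_taylor_two_real
  obtain ⟨ε', hε', hball⟩ := Metric.mem_nhds_iff.1 (hc.eventually (by simp))
  refine ⟨K, hK, min ε ε', by positivity, fun s hs t ht ↦ ?_⟩
  have hseg : segment ℝ s t ⊆ ball t₀ (min ε ε') := (convex_ball _ _).segment_subset hs ht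
  have hb1 : ball t₀ (min ε ε') ⊆ ball t₀ ε := ball_subset_ball (min_le_left _ _)
  have hb2 : ball t₀ (min ε ε') ⊆ ball t₀ ε' := ball_subset_ball (min_le_right _ _)
  have h2 := (convex_segment (𝕜 := ℝ) s t).norm_image_sub_le_of_norm_hasDerivWithin_le
    (f := fun x : ℝ ↦ c x - c s - (x - s) * deriv c s - (x - s) ^ 2 / 2 * deriv (deriv c) s)
    (f' := fun x ↦ deriv c x - deriv c s - (x - s) * deriv (deriv c) s)
    (C := K * |t - s| ^ 2) (fun x hx ↦ ?_) (fun x hx ↦ ?_)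
    (left_mem_segment ℝ s t) (right_mem_segment ℝ s t)
  · simp only [sub_self, zero_mul, Real.norm_eq_abs] at h2
    simp at h2
    refine h2.trans_eq (by rw [← sq_abs]; ring)
  · have e1 : HasDerivAt c (deriv c x) x :=
      ((show ContDiffAt ℝ 3 c x from hball (hb2 (hseg hx))).differentiableAt (by simp)).hasDerivAt
    have e2 : HasDerivAt (fun x : ℝ ↦ (x : ℂ) - s) 1 x :=
      ((Complex.ofRealCLM.hasDerivAt (x := x)).sub_const (s : ℂ)).congr_deriv (by simp)
    refine ((((e1.sub_const (c s)).fun_sub (e2.mul_const _)).fun_sub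
      (((e2.fun_pow 2).div_const 2).mul_const _)).congr_deriv ?_).hasDerivWithinAt
    push_cast
    ring
  · refine (h s (hb1 hs) x (hb1 (hseg hx))).trans ?_
    have := norm_sub_le_of_mem_segment hx
    rw [Real.norm_eq_abs, Real.norm_eq_abs] at this
    gcongr

/-- Local estimates for a regular plane curve: the curve lies between parabolas touching it at any
of its points, and every nearby point has a foot point on the curve. -/
theorem exists_parabola_estimate {c : ℝ → ℂ} {t₀ : ℝ} (hc : ContDiffAt ℝ 2 c t₀)
    (h0 : deriv c t₀ ≠ 0) :
    ∃ K > 0, ∃ m > 0, ∃ ε > 0, (∀ s ∈ ball t₀ ε, m ≤ ‖deriv c s‖ ∧ ‖deriv c s‖ ≤ m⁻¹ ∧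
        ‖c s - c t₀‖ ≤ 1) ∧
      (∀ s ∈ ball t₀ ε, ∀ t ∈ ball t₀ ε, |((c t - c s) / deriv c s).im| ≤
        K * (((c t - c s) / deriv c s) ^ 2).re) ∧
      (∀ᶠ w in nhds (c t₀), ∃ s ∈ ball t₀ ε, ((w - c s) / deriv c s).re = 0) := by
  obtain ⟨K₀, hK₀, ε₁, hε₁, hT⟩ := hc.exists_taylor_two_real
  have hdc : ContinuousAt (deriv c) t₀ :=
    (hc.derivWithin (m := 1) (by norm_num)).continuousAt
  set m₀ := ‖deriv c t₀‖ with hm₀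
  have hm₀' : 0 < m₀ := norm_pos_iff.2 h0
  set m := min (m₀ / 2) (m₀ + 1)⁻¹ with hm
  have hmpos : 0 < m := by positivity
  have hev : ∀ᶠ s in nhds t₀, (m₀ / 2 < ‖deriv c s‖ ∧ ‖deriv c s‖ < m₀ + 1) ∧ ‖c s - c t₀‖ < 1 ∧
      ContinuousAt c s ∧ ContinuousAt (deriv c) s := by
    refine (((hdc.norm.eventually (lt_mem_nhds (by linarith))).and
      (hdc.norm.eventually (gt_mem_nhds (by linarith)))).and ?_)
    refine Filter.Eventually.and ?_ ?_
    · have : ContinuousAt (fun s ↦ ‖c s - c t₀‖) t₀ := (hc.continuousAt.sub continuousAt_const).norm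
      exact this.eventually (gt_mem_nhds (by simp))
    · filter_upwards [hc.eventually (by simp)] with s hs
      exact ⟨hs.continuousAt, (hs.derivWithin (m := 1) (by norm_num)).continuousAt⟩
  obtain ⟨ε₂, hε₂, hball⟩ := Metric.mem_nhds_iff.1 hev
  set K := K₀ / m with hK
  have hKpos : 0 < K := by positivity
  set ε := min (min ε₁ ε₂) (1 / (8 * K)) with hε
  have hεpos : 0 < ε := by positivity
  have hb1 : ball t₀ ε ⊆ ball t₀ ε₁ :=
    ball_subset_ball ((min_le_left _ _).trans (min_le_left _ _))
  have hb2 : ball t₀ ε ⊆ ball t₀ ε₂ :=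
    ball_subset_ball ((min_le_left _ _).trans (min_le_right _ _))
  have hεK : K * ε ≤ 1 / 8 := by
    calc K * ε ≤ K * (1 / (8 * K)) := by gcongr; exact min_le_right _ _
      _ = 1 / 8 := by field_simp
  have hlow : ∀ s ∈ ball t₀ ε, m ≤ ‖deriv c s‖ := fun s hs ↦
    (min_le_left _ _).trans (hball (hb2 hs)).1.1.le
  have hL : ∀ s ∈ ball t₀ ε, ∀ t ∈ ball t₀ ε,
      ‖(c t - c s) / deriv c s - ((t - s : ℝ) : ℂ)‖ ≤ K * |t - s| ^ 2 := by
    intro s hs t ht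
    have h1 := hT s (hb1 hs) t (hb1 ht)
    have h2 := hlow s hs
    have h3 : deriv c s ≠ 0 := norm_pos_iff.1 (hmpos.trans_le h2)
    have h4 : (c t - c s) / deriv c s - ((t - s : ℝ) : ℂ) =
        (c t - c s - (t - s) * deriv c s) / deriv c s := by
      push_cast; field_simp
    rw [h4, norm_div, div_le_iff₀ (by positivity)]
    refine h1.trans ?_
    calc K₀ * |t - s| ^ 2 = K * |t - s| ^ 2 * m := by rw [hK]; field_simp
      _ ≤ _ := by gcongr
  refine ⟨2 * K, by positivity, m, hmpos, ε, hεpos, fun s hs ↦ ⟨hlow s hs, ?_, ?_⟩, ?_, ?_⟩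
  · have h1 := (hball (hb2 hs)).1.2.le
    refine h1.trans ?_
    rw [le_inv_comm₀ (by positivity) hmpos]
    exact min_le_right _ _
  · exact (hball (hb2 hs)).2.1.le
  · intro s hs t ht
    have h1 := hL s hs t ht
    set L := (c t - c s) / deriv c s with hLdef
    set Δ := t - s with hΔ
    have h2 : |L.re - Δ| ≤ K * |Δ| ^ 2 := by
      simpa using (Complex.abs_re_le_norm _).trans h1
    have h3 : |L.im| ≤ K * |Δ| ^ 2 := by
      simpa using (Complex.abs_im_le_norm _).trans h1
    have h4 : |Δ| < 2 * ε := by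
      have := dist_triangle_right t s t₀
      rw [Real.dist_eq] at this
      rw [mem_ball] at hs ht
      linarith
    have h5 : K * |Δ| ≤ 1 / 4 := by nlinarith [abs_nonneg Δ]
    have h6 : K * |Δ| ^ 2 ≤ |Δ| / 4 := by nlinarith [abs_nonneg Δ]
    have h7 : 3 / 4 * |Δ| ≤ |L.re| := by
      have := abs_sub_abs_le_abs_sub Δ L.re
      rw [abs_sub_comm Δ L.re] at this
      linarith
    have h8 : (L ^ 2).re = |L.re| ^ 2 - |L.im| ^ 2 := by rw [sq_abs, sq_abs, sq]; simp; ring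
    have h9 : |L.im| ^ 2 ≤ (|Δ| / 4) ^ 2 := by gcongr; exact h3.trans h6
    have h10 : (3 / 4 * |Δ|) ^ 2 ≤ |L.re| ^ 2 := by gcongr
    rw [h8]
    nlinarith
  · set r := ε / 2 with hr
    have hr0 : 0 < r := by positivity
    have hsub : Icc (t₀ - r) (t₀ + r) ⊆ ball t₀ ε := by
      intro x hx
      rw [mem_ball, Real.dist_eq, abs_lt]
      constructor <;> linarith [hx.1, hx.2]
    have ht₀ : t₀ ∈ ball t₀ ε := mem_ball_self hεpos
    filter_upwards [ball_mem_nhds (c t₀) (show 0 < m * (r / 4) by positivity)] with w hw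
    have hcl : ∀ s ∈ ball t₀ ε, |((w - c s) / deriv c s).re - (t₀ - s)| ≤
        K * |t₀ - s| ^ 2 + r / 4 := by
      intro s hs
      have h1 := hL s hs t₀ ht₀
      have h2 : (w - c s) / deriv c s - ((t₀ - s : ℝ) : ℂ) =
          ((c t₀ - c s) / deriv c s - ((t₀ - s : ℝ) : ℂ)) + (w - c t₀) / deriv c s := by ring
      have h3 : ‖(w - c t₀) / deriv c s‖ ≤ r / 4 := by
        rw [norm_div, div_le_iff₀ (hmpos.trans_le (hlow s hs))]
        rw [mem_ball_iff_norm] at hw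
        nlinarith [hlow s hs]
      have h4 : ‖(w - c s) / deriv c s - ((t₀ - s : ℝ) : ℂ)‖ ≤ K * |t₀ - s| ^ 2 + r / 4 := by
        rw [h2]
        exact (norm_add_le _ _).trans (add_le_add h1 h3)
      simpa using (Complex.abs_re_le_norm _).trans h4
    have hKr : K * r ^ 2 ≤ r / 4 := by nlinarith
    have hcont : ContinuousOn (fun s ↦ ((w - c s) / deriv c s).re) (Icc (t₀ - r) (t₀ + r)) := by
      intro s hs
      have h1 := hball (hb2 (hsub hs))
      refine (Complex.continuous_re.continuousAt.comp ?_).continuousWithinAt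
      exact (continuousAt_const.sub h1.2.2.1).div h1.2.2.2
        (norm_pos_iff.1 (hmpos.trans_le (hlow s (hsub hs))))
    have hle : t₀ - r ≤ t₀ + r := by linarith
    have h1 := hcl _ (hsub (left_mem_Icc.2 hle))
    have h2 := hcl _ (hsub (right_mem_Icc.2 hle))
    rw [show t₀ - (t₀ - r) = r by ring, abs_of_pos hr0, abs_le] at h1
    rw [show t₀ - (t₀ + r) = -r by ring, abs_neg, abs_of_pos hr0, abs_le] at h2
    obtain ⟨s, hs, hs0⟩ := intermediate_value_Icc' hle hcont
      (show (0 : ℝ) ∈ Icc _ _ from ⟨by linarith, by linarith⟩)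
    exact ⟨s, hsub hs, hs0⟩

/-- Radial projection to the unit circle. -/
theorem Complex.norm_sub_div_norm {z : ℂ} (hz : z ≠ 0) (hz1 : ‖z‖ ≤ 1) :
    ‖z - z / ‖z‖‖ = 1 - ‖z‖ := by
  have h : (‖z‖ : ℂ) ≠ 0 := by simpa using hz
  have h1 : z - z / ‖z‖ = -((1 - ‖z‖ : ℝ) : ℂ) * (z / ‖z‖) := by
    push_cast; field_simp; ring
  rw [h1, norm_mul, norm_neg, norm_real, Real.norm_of_nonneg (by linarith), norm_div, norm_real,
    norm_norm, div_self (norm_ne_zero_iff.2 hz), mul_one]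

theorem Complex.norm_div_norm_self {z : ℂ} (hz : z ≠ 0) : ‖z / ‖z‖‖ = 1 := by
  rw [norm_div, norm_real, norm_norm, div_self (norm_ne_zero_iff.2 hz)]

/-- A holomorphic function whose boundary values lie on a regular curve is Lipschitz up to the
boundary. -/
theorem exists_norm_deriv_bound {v : ℂ → ℂ} {c : ℝ → ℂ} {z₀ : ℂ} {t₀ ρ : ℝ} (hz₀ : ‖z₀‖ = 1)
    (hρ : 0 < ρ) (hvc : ContinuousOn v (closedBall 0 1 ∩ ball z₀ ρ))
    (hvd : DifferentiableOn ℂ v (ball 0 1 ∩ ball z₀ ρ)) (hc : ContDiffAt ℝ 2 c t₀)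
    (hc0 : c t₀ = v z₀) (h0 : deriv c t₀ ≠ 0)
    (hbd : ∀ ε > 0, ∀ᶠ z in nhdsWithin z₀ (sphere 0 1), ∃ t ∈ ball t₀ ε, v z = c t) :
    ∃ C > 0, ∃ r > 0, ∀ z ∈ ball (0 : ℂ) 1 ∩ ball z₀ r, ‖deriv v z‖ ≤ C := by
  obtain ⟨K, hK, m, hm, ε, hε, hder, hpar, hfoot⟩ := exists_parabola_estimate hc h0
  have hz₀c : z₀ ∈ closedBall (0 : ℂ) 1 ∩ ball z₀ ρ := ⟨by simp [hz₀], mem_ball_self hρ⟩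
  have hvt : Filter.Tendsto v (nhdsWithin z₀ (closedBall 0 1)) (nhds (c t₀)) := by
    rw [hc0]
    exact (hvc z₀ hz₀c).mono_of_mem_nhdsWithin
      (Filter.inter_mem self_mem_nhdsWithin (mem_nhdsWithin_of_mem_nhds (ball_mem_nhds z₀ hρ)))
  have hnear : ∀ᶠ w in nhds (c t₀), ‖w - c t₀‖ ≤ 1 := by
    filter_upwards [closedBall_mem_nhds (c t₀) one_pos] with w hw
    rwa [← mem_closedBall_iff_norm]
  obtain ⟨ρ₁, hρ₁, hball₁⟩ := Metric.mem_nhdsWithin_iff.1 (hvt.eventually (hfoot.and hnear))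
  obtain ⟨ρ₂, hρ₂, hball₂⟩ := Metric.mem_nhdsWithin_iff.1 (hbd ε hε)
  set δ := min (min ρ₁ ρ₂) (min ρ 1) / 2 with hδ
  have hδ0 : 0 < δ := by positivity
  have hδρ₁ : 2 * δ ≤ ρ₁ := by
    rw [hδ]; linarith [(min_le_left (min ρ₁ ρ₂) (min ρ 1)).trans (min_le_left _ _)]
  have hδρ₂ : 2 * δ ≤ ρ₂ := by
    rw [hδ]; linarith [(min_le_left (min ρ₁ ρ₂) (min ρ 1)).trans (min_le_right _ _)]
  have hδρ : 2 * δ ≤ ρ := by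
    rw [hδ]; linarith [(min_le_right (min ρ₁ ρ₂) (min ρ 1)).trans (min_le_left _ _)]
  have hδ1 : 2 * δ ≤ 1 := by
    rw [hδ]; linarith [(min_le_right (min ρ₁ ρ₂) (min ρ 1)).trans (min_le_right _ _)]
  set B : ℝ := 2 / m with hB
  have hB0 : 0 < B := by positivity
  set M : ℝ := B + K * B ^ 2 with hM
  have hM0 : 0 < M := by positivity
  set C : ℝ := 8 * M / δ ^ 2 with hC
  have hC0 : 0 < C := by positivity
  set r : ℝ := min (δ / 4) (1 / (4 * K * C)) with hr
  have hr0 : 0 < r := by positivity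
  refine ⟨12 * C * m⁻¹, by positivity, r, hr0, fun z hz ↦ ?_⟩
  have hz1 : ‖z‖ < 1 := mem_ball_zero_iff.1 hz.1
  have hzz₀ : ‖z - z₀‖ < r := mem_ball_iff_norm.1 hz.2
  have hrδ : r ≤ δ / 4 := min_le_left _ _
  have hd : 1 - ‖z‖ ≤ ‖z - z₀‖ := by
    have := norm_sub_norm_le z₀ z
    rw [norm_sub_rev, hz₀] at this
    exact this
  set d := 1 - ‖z‖ with hdd
  have hd0 : 0 < d := by linarith
  have hzne : z ≠ 0 := by
    rintro rfl
    simp at hdd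
    linarith
  set z₁ := z / ‖z‖ with hz₁
  have hz₁n : ‖z₁‖ = 1 := Complex.norm_div_norm_self hzne
  have hzz₁ : ‖z - z₁‖ = d := Complex.norm_sub_div_norm hzne hz1.le
  have hsub : ball z₁ δ ⊆ ball z₀ (2 * δ) := by
    intro w hw
    rw [mem_ball_iff_norm] at *
    have h1 : ‖w - z₀‖ ≤ ‖w - z₁‖ + ‖z - z₁‖ + ‖z - z₀‖ := by
      rw [norm_sub_rev z z₁]
      calc ‖w - z₀‖ = ‖(w - z₁) + (z₁ - z) + (z - z₀)‖ := by ring_nf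
        _ ≤ _ := norm_add₃_le
    linarith
  have hzz : z ∈ closedBall (0 : ℂ) 1 ∩ ball z₁ δ :=
    ⟨ball_subset_closedBall hz.1, by rw [mem_ball_iff_norm, hzz₁]; linarith⟩
  have hA : ∀ w ∈ closedBall (0 : ℂ) 1 ∩ ball z₁ δ, (∃ s ∈ ball t₀ ε,
      ((v w - c s) / deriv c s).re = 0) ∧ ‖v w - c t₀‖ ≤ 1 := fun w hw ↦
    hball₁ ⟨ball_subset_ball hδρ₁ (hsub hw.2), hw.1⟩
  obtain ⟨⟨s, hs, hs0⟩, -⟩ := hA z hzz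
  obtain ⟨hsl, hsu, hsc⟩ := hder s hs
  have hsne : deriv c s ≠ 0 := norm_pos_iff.1 (hm.trans_le hsl)
  set L : ℂ → ℂ := fun w ↦ (v w - c s) / deriv c s with hL
  have hvd' : DifferentiableOn ℂ v (ball 0 1 ∩ ball z₁ δ) :=
    hvd.mono (inter_subset_inter_right _ (hsub.trans (ball_subset_ball hδρ)))
  have hLd : DifferentiableOn ℂ L (ball 0 1 ∩ ball z₁ δ) := (hvd'.sub_const _).div_const _
  have hLc : ContinuousOn L (closedBall 0 1 ∩ ball z₁ δ) :=
    ((hvc.mono (inter_subset_inter_right _ (hsub.trans (ball_subset_ball hδρ)))).sub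
      continuousOn_const).div_const _
  have hLB : ∀ w ∈ closedBall (0 : ℂ) 1 ∩ ball z₁ δ, ‖L w‖ ≤ B := by
    intro w hw
    rw [hL, hB]
    simp only [norm_div]
    gcongr
    calc ‖v w - c s‖ = ‖(v w - c t₀) - (c s - c t₀)‖ := by ring_nf
      _ ≤ ‖v w - c t₀‖ + ‖c s - c t₀‖ := norm_sub_le _ _
      _ ≤ 2 := by linarith [(hA w hw).2]
  have hLb : ∀ w ∈ sphere (0 : ℂ) 1 ∩ ball z₁ δ, |(L w).im| ≤ K * (L w ^ 2).re := by
    intro w hw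
    obtain ⟨t, ht, hwt⟩ := hball₂ ⟨ball_subset_ball hδρ₂ (hsub hw.2), hw.1⟩
    rw [hL]
    simp only [hwt]
    exact hpar s hs t ht
  have key : ∀ e : ℝ, |e| = 1 → e * (L z).im + K * (L z).im ^ 2 ≤ C * d ∧
      ‖deriv L z * (-Complex.I * e - 2 * K * L z)‖ * d ≤
        2 * (2 * C * d - (e * (L z).im + K * (L z).im ^ 2)) := by
    intro e he
    have hre : ∀ w, (-Complex.I * e * L w - K * L w ^ 2).re = e * (L w).im - K * (L w ^ 2).re := by
      intro w; simp
    have hzre : (-Complex.I * e * L z - K * L z ^ 2).re = e * (L z).im + K * (L z).im ^ 2 := by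
      rw [hre, sq (L z), Complex.mul_re]
      change e * (L z).im - K * (((v z - c s) / deriv c s).re * _ - _) = _
      rw [hs0]; ring
    have hΨ := Complex.norm_deriv_mul_le_of_re_nonpos_on_sphere (z := z) (z₀ := z₁)
      (Ψ := fun w ↦ -Complex.I * e * L w - K * L w ^ 2) hz₁n hδ0 hM0.le
      ((hLd.const_mul _).sub ((hLd.pow 2).const_mul _))
      ((continuousOn_const.mul hLc).sub (continuousOn_const.mul (hLc.pow 2)))
      (fun w hw ↦ ?_) (fun w hw ↦ ?_) hz1 hzz₁ (by linarith)
    · have hLz : DifferentiableAt ℂ L z := hLd.differentiableAt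
        ((isOpen_ball.inter isOpen_ball).mem_nhds ⟨hz.1, hzz.2⟩)
      have hder' : deriv (fun w ↦ -Complex.I * e * L w - K * L w ^ 2) z =
          deriv L z * (-Complex.I * e - 2 * K * L z) := by
        rw [((hLz.hasDerivAt.const_mul (-Complex.I * (e : ℂ))).fun_sub
          ((hLz.hasDerivAt.fun_pow 2).const_mul (K : ℂ))).deriv]
        push_cast; ring
      rw [hder'] at hΨ
      simp only [hzre] at hΨ
      exact hΨ
    · rw [hre]
      have h1 := hLb w hw
      have h2 := le_abs_self (e * (L w).im)
      rw [abs_mul, he, one_mul] at h2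
      linarith
    · rw [hre]
      have h1 := hLB w hw
      have h2 := le_abs_self (e * (L w).im)
      rw [abs_mul, he, one_mul] at h2
      have h3 := Complex.abs_im_le_norm (L w)
      have h4 : -(L w ^ 2).re ≤ B ^ 2 := by
        refine (neg_le_abs _).trans ((Complex.abs_re_le_norm _).trans ?_)
        rw [norm_pow]
        gcongr
      rw [hM]
      nlinarith
  have k1 := key 1 (by simp)
  have k2 := (key (-1) (by simp)).1
  set Y := (L z).im with hY
  have hYK : 0 ≤ K * Y ^ 2 := by positivity
  have hYd : |Y| ≤ C * d := abs_le.2 ⟨by linarith, by linarith [k1.1]⟩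
  have hLz : ‖L z‖ = |Y| := by
    have : L z = Y * Complex.I := by
      apply Complex.ext
      · simpa using hs0
      · simp [hY]
    rw [this, norm_mul, Complex.norm_I, mul_one, Complex.norm_real, Real.norm_eq_abs]
  have hsmall : 2 * K * ‖L z‖ ≤ 1 / 2 := by
    rw [hLz]
    have h1 : d ≤ 1 / (4 * K * C) := (hd.trans hzz₀.le).trans (min_le_right _ _)
    calc 2 * K * |Y| ≤ 2 * K * (C * (1 / (4 * K * C))) := by
          gcongr
          exact hYd.trans (by gcongr)
      _ = 1 / 2 := by field_simp; norm_num
  have hfac : 1 / 2 ≤ ‖-Complex.I * (1 : ℝ) - 2 * K * L z‖ := by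
    have h1 := norm_sub_norm_le (-Complex.I * (1 : ℝ)) (2 * K * L z)
    have h2 : ‖(2 * K * L z : ℂ)‖ = 2 * K * ‖L z‖ := by
      rw [norm_mul, norm_mul, Complex.norm_real, Real.norm_of_nonneg hK.le]; simp
    have h3 : ‖-Complex.I * ((1 : ℝ) : ℂ)‖ = 1 := by simp
    rw [h2, h3] at h1
    linarith
  have hL12 : ‖deriv L z‖ ≤ 12 * C := by
    have h1 := k1.2
    rw [norm_mul] at h1
    have h2 : ‖deriv L z‖ * (1 / 2) * d ≤ 6 * C * d := by
      calc ‖deriv L z‖ * (1 / 2) * d ≤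
            ‖deriv L z‖ * ‖-Complex.I * (1 : ℝ) - 2 * K * L z‖ * d := by gcongr
        _ ≤ _ := h1
        _ ≤ 6 * C * d := by linarith [neg_abs_le Y]
    have := le_of_mul_le_mul_right h2 hd0
    linarith
  have hvz : DifferentiableAt ℂ v z := hvd'.differentiableAt
    ((isOpen_ball.inter isOpen_ball).mem_nhds ⟨hz.1, hzz.2⟩)
  have hLv : deriv L z = deriv v z / deriv c s := by
    rw [hL, ((hvz.hasDerivAt.sub_const (c s)).div_const _).deriv]
  rw [hLv, norm_div, div_le_iff₀ (hm.trans_le hsl)] at hL12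
  refine hL12.trans ?_
  gcongr

/-- The imaginary part of a function with bounded derivative near a boundary point of the disc,
estimated by radial integration from the boundary. -/
theorem abs_im_le_of_norm_deriv_le {F : ℂ → ℂ} {z₀ z : ℂ} {δ Λ K : ℝ} (hz₀ : ‖z₀‖ = 1)
    (hδ : δ ≤ 1) (hΛ : 0 < Λ) (hK : 0 < K) (hd : DifferentiableOn ℂ F (ball 0 1 ∩ ball z₀ δ))
    (hc : ContinuousOn F (closedBall 0 1 ∩ ball z₀ δ))
    (hF : ∀ z ∈ ball (0 : ℂ) 1 ∩ ball z₀ δ, ‖deriv F z‖ ≤ Λ * (1 + K * ‖z - z₀‖ ^ 2))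
    (hb : ∀ z ∈ sphere (0 : ℂ) 1 ∩ ball z₀ δ, |(F z).im| ≤ K * ‖z - z₀‖ ^ 3)
    (hz : z ∈ closedBall (0 : ℂ) 1 ∩ ball z₀ (δ / 2)) :
    |(F z).im| ≤ Λ * (1 - ‖z‖) + (8 * K + 4 * Λ * K) * ‖z - z₀‖ ^ 3 := by
  have hz1 : ‖z‖ ≤ 1 := mem_closedBall_zero_iff.1 hz.1
  have hzδ : ‖z - z₀‖ < δ / 2 := mem_ball_iff_norm.1 hz.2
  set r := ‖z - z₀‖ with hr
  have hr0 : 0 ≤ r := norm_nonneg _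
  have hdr : 1 - ‖z‖ ≤ r := by
    have := norm_sub_norm_le z₀ z
    rw [norm_sub_rev, hz₀] at this
    exact this
  have hzne : z ≠ 0 := by
    rintro rfl
    simp at hdr
    linarith
  set z₁ := z / ‖z‖ with hz₁
  have hz₁n : ‖z₁‖ = 1 := Complex.norm_div_norm_self hzne
  have hzz₁ : ‖z - z₁‖ = 1 - ‖z‖ := Complex.norm_sub_div_norm hzne hz1
  have hz₁r : ‖z₁ - z₀‖ ≤ 2 * r := by
    calc ‖z₁ - z₀‖ = ‖(z₁ - z) + (z - z₀)‖ := by ring_nf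
      _ ≤ ‖z₁ - z‖ + ‖z - z₀‖ := norm_add_le _ _
      _ ≤ 2 * r := by rw [norm_sub_rev, hzz₁]; linarith
  have h1 : |(F z₁).im| ≤ 8 * K * r ^ 3 := by
    refine (hb z₁ ⟨by simpa using hz₁n, mem_ball_iff_norm.2 (by linarith)⟩).trans ?_
    calc K * ‖z₁ - z₀‖ ^ 3 ≤ K * (2 * r) ^ 3 := by gcongr
      _ = _ := by ring
  have h2 : ‖F z₁ - F z‖ ≤ Λ * (1 + K * (2 * r) ^ 2) * (1 - ‖z‖) := by
    rcases hz1.lt_or_eq with hlt | heq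
    · set l : ℝ → ℂ := fun s ↦ z + s * (z₁ - z) with hl
      have hl' : ∀ s, l s = (1 - s : ℝ) • z + s • z₁ := fun s ↦ by
        simp [hl]; ring
      have hlr : ∀ s ∈ Icc (0 : ℝ) 1, ‖l s - z₀‖ ≤ 2 * r := by
        intro s hs
        have hcv := (convex_closedBall z₀ (2 * r)) (x := z) (y := z₁)
          (by rw [mem_closedBall_iff_norm]; linarith) (by rwa [mem_closedBall_iff_norm])
          (sub_nonneg.2 hs.2) hs.1 (by ring)
        rw [← mem_closedBall_iff_norm, hl']
        exact hcv
      have hln : ∀ s, 0 ≤ s → s ≤ 1 → ‖l s‖ ≤ (1 - s) * ‖z‖ + s := by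
        intro s hs hs1
        rw [hl']
        refine (norm_add_le _ _).trans ?_
        rw [norm_smul, norm_smul, hz₁n, Real.norm_of_nonneg (by linarith), Real.norm_of_nonneg hs,
          mul_one]
      have hlcont : Continuous l := by fun_prop
      have h3 := norm_image_sub_le_of_norm_deriv_right_le_segment (f := fun s ↦ F (l s))
        (f' := fun s ↦ deriv F (l s) * (z₁ - z)) (a := 0) (b := 1)
        (C := Λ * (1 + K * (2 * r) ^ 2) * (1 - ‖z‖)) ?_ (fun s hs ↦ ?_) (fun s hs ↦ ?_) 1
        (right_mem_Icc.2 zero_le_one)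
      · simpa [hl] using h3
      · refine hc.comp hlcont.continuousOn fun s hs ↦ ⟨?_, ?_⟩
        · rw [mem_closedBall_zero_iff]
          exact (hln s hs.1 hs.2).trans (by nlinarith [hs.1, hs.2])
        · rw [mem_ball_iff_norm]
          exact (hlr s hs).trans_lt (by linarith)
      · have hmem : l s ∈ ball (0 : ℂ) 1 ∩ ball z₀ δ := by
          refine ⟨?_, ?_⟩
          · rw [mem_ball_zero_iff]
            exact (hln s hs.1 hs.2.le).trans_lt (by nlinarith [hs.1, hs.2])
          · rw [mem_ball_iff_norm]
            exact (hlr s ⟨hs.1, hs.2.le⟩).trans_lt (by linarith)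
        have e1 : HasDerivAt l (z₁ - z) s := by
          have := (((Complex.ofRealCLM.hasDerivAt (x := s)).mul_const (z₁ - z)).const_add z)
          rwa [Complex.ofRealCLM_apply, Complex.ofReal_one, one_mul] at this
        have e2 := (hd.differentiableAt ((isOpen_ball.inter isOpen_ball).mem_nhds hmem)).hasDerivAt
        exact (e2.comp_of_eq s e1 rfl).hasDerivWithinAt
      · have hmem : l s ∈ ball (0 : ℂ) 1 ∩ ball z₀ δ := by
          refine ⟨?_, ?_⟩
          · rw [mem_ball_zero_iff]
            exact (hln s hs.1 hs.2.le).trans_lt (by nlinarith [hs.1, hs.2])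
          · rw [mem_ball_iff_norm]
            exact (hlr s ⟨hs.1, hs.2.le⟩).trans_lt (by linarith)
        rw [norm_mul, norm_sub_rev z₁, hzz₁]
        have h4 := hlr s ⟨hs.1, hs.2.le⟩
        gcongr
        refine (hF _ hmem).trans ?_
        gcongr
    · have : z₁ = z := by rw [hz₁, heq]; simp
      rw [this, heq]
      simp
  have h3 : |(F z).im| ≤ |(F z₁).im| + ‖F z₁ - F z‖ := by
    have h4 := Complex.abs_im_le_norm (F z₁ - F z)
    rw [Complex.sub_im] at h4
    have h5 := abs_sub_abs_le_abs_sub (F z).im (F z₁).im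
    rw [abs_sub_comm] at h5
    linarith
  have h4 : Λ * K * (2 * r) ^ 2 * (1 - ‖z‖) ≤ Λ * K * (2 * r) ^ 2 * r := by gcongr
  nlinarith

theorem one_sub_norm_le_of_sq_eq {x s : ℝ} (hx0 : 0 ≤ x) (hx : x ≤ 1 / 2) (hs : 0 ≤ s)
    (h : s ^ 2 = 1 - x) : 1 - s ≤ x / 2 + x ^ 2 / 8 + x ^ 3 / 8 := by
  set y := x / 2 + x ^ 2 / 8 + x ^ 3 / 8 with hy
  have h1 : (1 - y) ^ 2 ≤ s ^ 2 := by
    have : s ^ 2 - (1 - y) ^ 2 = x ^ 3 / 8 * (1 - x - x * (1 + x) ^ 2 / 8) := by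
      rw [h, hy]; ring
    have h2 : 0 ≤ 1 - x - x * (1 + x) ^ 2 / 8 := by nlinarith [mul_nonneg hx0 hx0]
    have h3 : 0 ≤ x ^ 3 / 8 * (1 - x - x * (1 + x) ^ 2 / 8) := by positivity
    linarith
  have h2 := abs_le_of_sq_le_sq h1 hs
  linarith [le_abs_self (1 - y)]

/-- On the circle with diameter `[0, 2κ]`, the distance to the unit circle around `1` is
dominated by a harmonic polynomial whose slope at `0` is less than `1`. -/
theorem one_sub_norm_add_le {ζ : ℂ} {κ : ℝ} (hκ : 0 < κ) (hκ1 : κ ≤ 1 / 32)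
    (hζ : ‖ζ - κ‖ = κ) :
    1 - ‖1 - ζ‖ + ζ.re * κ / 8 ≤ ((1 - κ / 4) * ζ + ζ ^ 2 / 4).re ∧ ‖ζ‖ ^ 2 = 2 * κ * ζ.re ∧
      0 ≤ ζ.re ∧ ‖ζ‖ ≤ 2 * κ := by
  have h1 : ‖ζ - κ‖ ^ 2 = κ ^ 2 := by rw [hζ]
  have h2 : ‖1 - ζ‖ ^ 2 = (1 - ζ.re) ^ 2 + ζ.im ^ 2 := by
    rw [← Complex.normSq_eq_norm_sq, Complex.normSq_apply]; simp; ring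
  rw [← Complex.normSq_eq_norm_sq, Complex.normSq_apply] at h1
  simp at h1
  set p := ζ.re with hp
  have h3 : ζ.im ^ 2 = 2 * κ * p - p ^ 2 := by nlinarith
  have h4 : ‖ζ‖ ^ 2 = 2 * κ * p := by
    rw [← Complex.normSq_eq_norm_sq, Complex.normSq_apply, ← hp]; nlinarith
  have hp0 : 0 ≤ p := by nlinarith [sq_nonneg ‖ζ‖]
  have h6 : ‖ζ‖ ≤ 2 * κ := by
    calc ‖ζ‖ = ‖(ζ - κ) + κ‖ := by ring_nf
      _ ≤ ‖ζ - κ‖ + ‖(κ : ℂ)‖ := norm_add_le _ _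
      _ = 2 * κ := by rw [hζ, Complex.norm_real, Real.norm_of_nonneg hκ.le]; ring
  have hp2 : p ≤ 2 * κ := (Complex.re_le_norm ζ).trans h6
  refine ⟨?_, h4, hp0, h6⟩
  have h7 := one_sub_norm_le_of_sq_eq (x := 2 * p * (1 - κ)) (by nlinarith) (by nlinarith)
    (norm_nonneg (1 - ζ)) (by rw [h2, h3]; ring)
  have h8 : ((1 - κ / 4) * ζ + ζ ^ 2 / 4).re = p * (1 - 3 * κ / 4 + p / 2) := by
    have e1 : ((1 - κ / 4) * ζ + ζ ^ 2 / 4) =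
        ((1 - κ / 4 : ℝ) : ℂ) * ζ + ((1 / 4 : ℝ) : ℂ) * (ζ * ζ) := by push_cast; ring
    rw [e1, Complex.add_re, Complex.re_ofReal_mul, Complex.re_ofReal_mul, Complex.mul_re, ← hp]
    nlinarith
  rw [h8]
  have h9 : p ^ 3 ≤ 4 * κ ^ 2 * p := by
    have : p ^ 2 ≤ (2 * κ) ^ 2 := by gcongr
    nlinarith
  have h10 : (1 - κ) ^ 3 ≤ 1 := pow_le_one₀ (by linarith) (by linarith)
  have h11 : p ^ 3 * (1 - κ) ^ 3 ≤ 4 * κ ^ 2 * p := by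
    have : 0 ≤ p ^ 3 := by positivity
    nlinarith
  have h12 : 0 ≤ p * κ := by positivity
  have h13 : κ ^ 2 * p ≤ p * κ / 32 := by nlinarith
  have h14 : 0 ≤ p ^ 2 * (2 * κ - κ ^ 2) := by
    have : 0 ≤ 2 * κ - κ ^ 2 := by nlinarith
    positivity
  have e : 2 * p * (1 - κ) / 2 + (2 * p * (1 - κ)) ^ 2 / 8 + (2 * p * (1 - κ)) ^ 3 / 8 =
      p - p * κ + p ^ 2 / 2 - p ^ 2 * (2 * κ - κ ^ 2) / 2 + p ^ 3 * (1 - κ) ^ 3 := by ring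
  rw [e] at h7
  nlinarith

theorem sq_add_sq_mul_sq_le {a b D k u t : ℝ} (ha : 0 ≤ a) (hb : 0 ≤ b) (hD : 0 ≤ D)
    (h1 : a * D ≤ k * (u - t)) (h2 : b * D ≤ k * (u + t)) (h3 : t ≤ u) (h4 : -t ≤ u) :
    (a ^ 2 + b ^ 2) * D ^ 2 ≤ 4 * (k * u) ^ 2 := by
  have e1 := pow_le_pow_left₀ (by positivity) h1 2
  have e2 := pow_le_pow_left₀ (by positivity) h2 2
  have e3 : t ^ 2 ≤ u ^ 2 := sq_le_sq' (by linarith) h3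
  have e4 : k ^ 2 * t ^ 2 ≤ k ^ 2 * u ^ 2 := by gcongr
  calc (a ^ 2 + b ^ 2) * D ^ 2 = (a * D) ^ 2 + (b * D) ^ 2 := by ring
    _ ≤ (k * (u - t)) ^ 2 + (k * (u + t)) ^ 2 := add_le_add e1 e2
    _ = 2 * (k ^ 2 * u ^ 2) + 2 * (k ^ 2 * t ^ 2) := by ring
    _ ≤ 2 * (k ^ 2 * u ^ 2) + 2 * (k ^ 2 * u ^ 2) := by linarith
    _ = 4 * (k * u) ^ 2 := by ring

theorem norm_deriv_sq_le_of_real_on_sphere {Λ K δ κ d : ℝ} {z₀ : ℂ} {F : ℂ → ℂ} (hΛ : 0 < Λ)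
    (hK : 0 < K) (hδ1 : δ ≤ 1) (hκ0 : 0 < κ) (hκ1 : κ ≤ 1 / 32) (hκδ : κ ≤ δ / 8)
    (hκK : 32 * (8 * K + 4 * Λ * K) * κ ≤ Λ) (hz₀ : ‖z₀‖ = 1)
    (hFd : DifferentiableOn ℂ F (ball 0 1 ∩ ball z₀ δ))
    (hFc : ContinuousOn F (closedBall 0 1 ∩ ball z₀ δ))
    (hF : ∀ z ∈ ball (0 : ℂ) 1 ∩ ball z₀ δ, ‖deriv F z‖ ≤ Λ * (1 + K * ‖z - z₀‖ ^ 2))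
    (hb : ∀ z ∈ sphere (0 : ℂ) 1 ∩ ball z₀ δ, |(F z).im| ≤ K * ‖z - z₀‖ ^ 3)
    (hd : 0 < d) (hdκ : d < κ) :
    ‖deriv F (z₀ * (1 - d))‖ ^ 2 ≤ Λ ^ 2 * (2 * (2 * κ / (2 * κ - d) *
      (1 - κ / 4 + d / 4)) ^ 2 - (1 - κ / 4 + d / 2) ^ 2) := by
  set K' := 8 * K + 4 * Λ * K with hK'
  have hK'0 : 0 < K' := by positivity
  set T : ℂ → ℂ := fun ζ ↦ z₀ * (1 - ζ) with hT
  have hTn : ∀ ζ, ‖T ζ‖ = ‖1 - ζ‖ := fun ζ ↦ by rw [hT]; simp [hz₀]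
  have hTz : ∀ ζ, ‖T ζ - z₀‖ = ‖ζ‖ := fun ζ ↦ by
    have : T ζ - z₀ = -(z₀ * ζ) := by rw [hT]; ring
    rw [this, norm_neg, norm_mul, hz₀, one_mul]
  have hζ2 : ∀ ζ ∈ closedBall (κ : ℂ) κ, ‖ζ‖ ≤ 2 * κ := by
    intro ζ hζ
    rw [mem_closedBall_iff_norm] at hζ
    calc ‖ζ‖ = ‖(ζ - κ) + κ‖ := by ring_nf
      _ ≤ ‖ζ - κ‖ + ‖(κ : ℂ)‖ := norm_add_le _ _
      _ ≤ 2 * κ := by rw [Complex.norm_real, Real.norm_of_nonneg hκ0.le]; linarith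
  have h1κ : ‖(1 : ℂ) - κ‖ = 1 - κ := by
    have : (1 : ℂ) - κ = ((1 - κ : ℝ) : ℂ) := by push_cast; ring
    rw [this, Complex.norm_real, Real.norm_of_nonneg (by linarith)]
  have hζ1 : ∀ ζ, ‖T ζ‖ ≤ (1 - κ) + ‖ζ - κ‖ := by
    intro ζ
    rw [hTn]
    calc ‖1 - ζ‖ = ‖(1 - κ) - (ζ - κ)‖ := by ring_nf
      _ ≤ _ := (norm_sub_le _ _).trans_eq (by rw [h1κ])
  have hTcl : ∀ ζ ∈ closedBall (κ : ℂ) κ, T ζ ∈ closedBall (0 : ℂ) 1 ∩ ball z₀ (δ / 2) := by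
    intro ζ hζ
    refine ⟨?_, ?_⟩
    · rw [mem_closedBall_zero_iff]
      rw [mem_closedBall_iff_norm] at hζ
      linarith [hζ1 ζ]
    · rw [mem_ball_iff_norm, hTz]
      linarith [hζ2 ζ hζ]
  have hTo : ∀ ζ ∈ ball (κ : ℂ) κ, T ζ ∈ ball (0 : ℂ) 1 ∩ ball z₀ δ := by
    intro ζ hζ
    refine ⟨?_, ball_subset_ball (by linarith) (hTcl ζ (ball_subset_closedBall hζ)).2⟩
    rw [mem_ball_zero_iff]
    rw [mem_ball_iff_norm] at hζ
    linarith [hζ1 ζ]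
  have hTd : Differentiable ℂ T := by fun_prop
  set Q : ℂ → ℂ := fun ζ ↦ Λ * ((1 - κ / 4) * ζ + ζ ^ 2 / 4) with hQ
  have hre : ∀ (e : ℝ) (ζ : ℂ), (Q ζ + e * Complex.I * F (T ζ)).re =
      Λ * ((1 - κ / 4) * ζ + ζ ^ 2 / 4).re - e * (F (T ζ)).im := by
    intro e ζ
    rw [Complex.add_re, hQ, Complex.re_ofReal_mul, mul_assoc, Complex.re_ofReal_mul]
    simp; ring
  have hdmem : (d : ℂ) ∈ ball (κ : ℂ) κ := by
    rw [mem_ball_iff_norm, ← Complex.ofReal_sub, Complex.norm_real, Real.norm_eq_abs, abs_lt]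
    constructor <;> linarith
  have hAdiff : ∀ e : ℝ, DifferentiableOn ℂ (fun ζ ↦ Q ζ + e * Complex.I * F (T ζ))
      (ball (κ : ℂ) κ) := fun e ↦
    DifferentiableOn.add (by fun_prop) ((hFd.comp hTd.differentiableOn hTo).const_mul _)
  have hpos : ∀ e : ℝ, |e| = 1 → ∀ ζ ∈ ball (κ : ℂ) κ,
      0 ≤ (Q ζ + e * Complex.I * F (T ζ)).re := by
    intro e he ζ hζ
    refine Complex.re_nonneg_of_forall_mem_frontier isBounded_ball
      (A := fun ζ ↦ Q ζ + e * Complex.I * F (T ζ)) ⟨hAdiff e, ?_⟩ (fun w hw ↦ ?_)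
      (subset_closure hζ)
    · rw [closure_ball _ hκ0.ne']
      refine ContinuousOn.add (by fun_prop) (continuousOn_const.mul (hFc.comp
        hTd.continuous.continuousOn fun w hw ↦ ?_))
      exact ⟨(hTcl w hw).1, ball_subset_ball (by linarith) (hTcl w hw).2⟩
    · rw [frontier_ball _ hκ0.ne'] at hw
      have hwn := mem_sphere_iff_norm.1 hw
      obtain ⟨k1, k2, k3, k4⟩ := one_sub_norm_add_le hκ0 hκ1 hwn
      have k5 := abs_im_le_of_norm_deriv_le hz₀ hδ1 hΛ hK hFd hFc hF hb
        (hTcl w (sphere_subset_closedBall hw))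
      rw [hTn, hTz, ← hK'] at k5
      have k6 : K' * ‖w‖ ^ 3 ≤ Λ * (w.re * κ / 8) := by
        calc K' * ‖w‖ ^ 3 = K' * (‖w‖ ^ 2 * ‖w‖) := by ring
          _ ≤ K' * (2 * κ * w.re * (2 * κ)) := by
            rw [k2]; gcongr
          _ = 32 * K' * κ * (w.re * κ / 8) := by ring
          _ ≤ Λ * (w.re * κ / 8) := by gcongr
      have k7 := mul_le_mul_of_nonneg_left k1 hΛ.le
      have k8 := le_abs_self (e * (F (T w)).im)
      rw [abs_mul, he, one_mul] at k8
      rw [hre]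
      linarith
  have hSP := fun (e : ℝ) (he : |e| = 1) ↦ Complex.norm_deriv_mul_le_of_re_nonneg_of_ball hd
    (by linarith) (hAdiff e) (hpos e he)
  set t := (F (T d)).im with ht
  set q := (1 - κ / 4) * d + d ^ 2 / 4 with hq
  have hqre : ((1 - (κ : ℂ) / 4) * d + (d : ℂ) ^ 2 / 4).re = q := by
    have : (1 - (κ : ℂ) / 4) * d + (d : ℂ) ^ 2 / 4 = ((q : ℝ) : ℂ) := by rw [hq]; push_cast; ring
    rw [this, Complex.ofReal_re]
  set P : ℝ := Λ * (1 - κ / 4 + d / 2) with hP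
  set G : ℂ := -(Complex.I * z₀ * deriv F (T d)) with hG
  have hFT : HasDerivAt (fun ζ ↦ F (T ζ)) (deriv F (T d) * -z₀) d := by
    have e1 : HasDerivAt T (-z₀) d :=
      (((hasDerivAt_id (d : ℂ)).const_sub 1).const_mul z₀).congr_deriv (by simp)
    exact (hFd.differentiableAt ((isOpen_ball.inter isOpen_ball).mem_nhds
      (hTo _ hdmem))).hasDerivAt.comp (d : ℂ) e1
  have hQd : HasDerivAt Q P d := by
    have e1 : HasDerivAt (fun ζ : ℂ ↦ (1 - κ / 4) * ζ + ζ ^ 2 / 4)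
        ((1 - κ / 4) * 1 + (2 : ℕ) * (d : ℂ) ^ 1 * 1 / 4) d :=
      ((hasDerivAt_id (d : ℂ)).const_mul _).add (((hasDerivAt_id (d : ℂ)).fun_pow 2).div_const 4)
    refine (e1.const_mul (Λ : ℂ)).congr_deriv ?_
    rw [hP]; push_cast; ring
  have hderiv : ∀ e : ℝ, deriv (fun ζ ↦ Q ζ + e * Complex.I * F (T ζ)) d = P + e * G := by
    intro e
    rw [(hQd.fun_add (hFT.const_mul (e * Complex.I))).deriv, hG]
    ring
  have s1 := hSP 1 (by simp)
  have s2 := hSP (-1) (by simp)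
  rw [hderiv, hre, hqre, ← ht] at s1 s2
  have p1 := hpos 1 (by simp) d hdmem
  have p2 := hpos (-1) (by simp) d hdmem
  rw [hre, hqre, ← ht] at p1 p2
  set D := d * (2 * κ - d) with hD
  have hD0 : 0 < D := mul_pos hd (by linarith)
  have hpar : ‖(P : ℂ) + (1 : ℝ) * G‖ ^ 2 + ‖(P : ℂ) + (-1 : ℝ) * G‖ ^ 2 =
      2 * P ^ 2 + 2 * ‖G‖ ^ 2 := by
    rw [← Complex.normSq_eq_norm_sq, ← Complex.normSq_eq_norm_sq, ← Complex.normSq_eq_norm_sq,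
      Complex.normSq_apply, Complex.normSq_apply, Complex.normSq_apply]
    simp
    ring
  have hGn : ‖G‖ = ‖deriv F (T d)‖ := by rw [hG]; simp [hz₀]
  have hmain : ‖G‖ ^ 2 * D ^ 2 ≤ 2 * (2 * κ * (Λ * q)) ^ 2 - P ^ 2 * D ^ 2 := by
    have h3 := sq_add_sq_mul_sq_le (norm_nonneg _) (norm_nonneg _) hD0.le
      (s1.trans_eq (by rw [one_mul])) (s2.trans_eq (by rw [neg_one_mul, sub_neg_eq_add]))
      (t := t) (u := Λ * q) (k := 2 * κ) (by linarith) (by linarith)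
    rw [hpar] at h3
    linarith
  rw [← hGn]
  rw [← mul_le_mul_iff_of_pos_right (show 0 < D ^ 2 by positivity)]
  refine hmain.trans_eq ?_
  have h2κ : 2 * κ - d ≠ 0 := by linarith
  rw [hP, hD, hq]
  field_simp

/-- If a holomorphic function near a boundary point of the disc has derivative bounded by `Λ` and
is real on the boundary, both up to higher order, then its derivative is strictly less than `Λ`
on the inner normal close to the boundary point. -/
theorem exists_norm_deriv_le_of_real_on_sphere {Λ K δ : ℝ} (hΛ : 0 < Λ) (hK : 0 < K) (hδ : 0 < δ)
    (hδ1 : δ ≤ 1) :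
    ∃ Λ' < Λ, ∃ d₀ > 0, ∀ (z₀ : ℂ) (F : ℂ → ℂ), ‖z₀‖ = 1 →
      DifferentiableOn ℂ F (ball 0 1 ∩ ball z₀ δ) →
      ContinuousOn F (closedBall 0 1 ∩ ball z₀ δ) →
      (∀ z ∈ ball (0 : ℂ) 1 ∩ ball z₀ δ, ‖deriv F z‖ ≤ Λ * (1 + K * ‖z - z₀‖ ^ 2)) →
      (∀ z ∈ sphere (0 : ℂ) 1 ∩ ball z₀ δ, |(F z).im| ≤ K * ‖z - z₀‖ ^ 3) →
      ∀ d : ℝ, 0 < d → d < d₀ → ‖deriv F (z₀ * (1 - d))‖ ≤ Λ' := by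
  set K' := 8 * K + 4 * Λ * K with hK'
  have hK'0 : 0 < K' := by positivity
  set κ := min (min (1 / 32) (δ / 8)) (Λ / (32 * K')) with hκ
  have hκ0 : 0 < κ := by positivity
  have hκ1 : κ ≤ 1 / 32 := (min_le_left _ _).trans (min_le_left _ _)
  have hκδ : κ ≤ δ / 8 := (min_le_left _ _).trans (min_le_right _ _)
  have hκK : 32 * K' * κ ≤ Λ := by
    calc 32 * K' * κ ≤ 32 * K' * (Λ / (32 * K')) := by gcongr; exact min_le_right _ _
      _ = Λ := by field_simp
  set Θ : ℝ → ℝ := fun d ↦ 2 * (2 * κ / (2 * κ - d) * (1 - κ / 4 + d / 4)) ^ 2 -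
    (1 - κ / 4 + d / 2) ^ 2 with hΘ
  have hΘc : ContinuousAt Θ 0 := by
    have h1 : ContinuousAt (fun d : ℝ ↦ 2 * κ / (2 * κ - d)) 0 :=
      continuousAt_const.div (by fun_prop) (by simp [hκ0.ne'])
    exact (((h1.mul (by fun_prop)).pow 2).const_mul 2).sub (by fun_prop)
  have hΘ0 : Θ 0 < (1 - κ / 8) ^ 2 := by
    have : Θ 0 = (1 - κ / 4) ^ 2 := by
      simp only [hΘ, sub_zero, zero_div, add_zero]
      rw [div_self (by positivity)]; ring
    rw [this]
    nlinarith
  obtain ⟨d₁, hd₁, hball⟩ := Metric.mem_nhds_iff.1 (hΘc.eventually (gt_mem_nhds hΘ0))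
  refine ⟨Λ * (1 - κ / 8), by nlinarith, min d₁ κ, by positivity, ?_⟩
  intro z₀ F hz₀ hFd hFc hF hb d hd hdlt
  have hdd₁ : d < d₁ := hdlt.trans_le (min_le_left _ _)
  have hdκ : d < κ := hdlt.trans_le (min_le_right _ _)
  have hfin : ‖deriv F (z₀ * (1 - d))‖ ^ 2 ≤ (Λ * (1 - κ / 8)) ^ 2 := by
    refine (norm_deriv_sq_le_of_real_on_sphere hΛ hK hδ1 hκ0 hκ1 hκδ hκK hz₀ hFd hFc hF hb hd
      hdκ).trans ?_
    have : Θ d < (1 - κ / 8) ^ 2 := hball (by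
      rw [mem_ball, Real.dist_eq, sub_zero, abs_of_pos hd]; exact hdd₁)
    rw [mul_pow Λ]
    exact mul_le_mul_of_nonneg_left this.le (by positivity)
  have := abs_le_of_sq_le_sq hfin (by nlinarith)
  rwa [abs_of_nonneg (norm_nonneg _)] at this

/-- Comparison of a conformal factor with the one of a holomorphic normal coordinate. -/
theorem exp_half_mul_norm_one_add_le {σ₀ σ₁ B : ℝ} {x : ℂ} (hx : ‖x‖ ≤ 1 / 3)
    (hB : |σ₁ - σ₀ - 2 * x.re| ≤ B) (hB1 : B ≤ 1) :
    Real.exp (σ₀ / 2) * ‖1 + x‖ ≤ Real.exp (σ₁ / 2) * (1 + (6 * ‖x‖ ^ 2 + 2 * B)) ∧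
      Real.exp (σ₁ / 2) ≤ Real.exp (σ₀ / 2) * ‖1 + x‖ * (1 + (6 * ‖x‖ ^ 2 + 2 * B)) := by
  set η := σ₁ - σ₀ - 2 * x.re with hη
  have hB0 : 0 ≤ B := (abs_nonneg _).trans hB
  have hη2 : |η / 2| ≤ 1 := by rw [abs_div, abs_two]; linarith
  have hx2 : ‖x‖ ^ 2 ≤ (1 / 3) ^ 2 := by gcongr
  set y := (1 + x) * Complex.exp (-x) with hy
  have hR : ‖y - 1‖ ≤ 3 * ‖x‖ ^ 2 := by
    have h1 : ‖Complex.exp (-x) - 1 - -x‖ ≤ ‖x‖ ^ 2 := by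
      simpa using Complex.norm_exp_sub_one_sub_id_le (x := -x) (by rw [norm_neg]; linarith)
    have h2 : y - 1 = -x ^ 2 + (1 + x) * (Complex.exp (-x) - 1 - -x) := by rw [hy]; ring
    have h3 : ‖1 + x‖ ≤ 2 := (norm_add_le _ _).trans (by rw [norm_one]; linarith)
    rw [h2]
    calc _ ≤ ‖-x ^ 2‖ + ‖(1 + x) * (Complex.exp (-x) - 1 - -x)‖ := norm_add_le _ _
      _ ≤ ‖x‖ ^ 2 + 2 * ‖x‖ ^ 2 := by
        rw [norm_neg, norm_pow, norm_mul]
        gcongr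
      _ = _ := by ring
  have hyu : ‖y‖ ≤ 1 + 3 * ‖x‖ ^ 2 := by
    have := norm_sub_norm_le y 1
    rw [norm_one] at this
    linarith
  have hyl : 1 - 3 * ‖x‖ ^ 2 ≤ ‖y‖ := by
    have := norm_sub_norm_le 1 y
    rw [norm_one, norm_sub_rev] at this
    linarith
  have hyx : ‖1 + x‖ = ‖y‖ * Real.exp x.re := by
    rw [hy, norm_mul, Complex.norm_exp, Complex.neg_re, mul_assoc, ← Real.exp_add]
    simp
  have hσ : σ₁ / 2 = σ₀ / 2 + x.re + η / 2 := by rw [hη]; ring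
  have hσ' : σ₀ / 2 + x.re = σ₁ / 2 + -(η / 2) := by rw [hη]; ring
  have hexp : ∀ s : ℝ, |s| = |η / 2| → Real.exp s ≤ 1 + B := by
    intro s hs
    have h1 := Real.abs_exp_sub_one_le (x := s) (by rw [hs]; exact hη2)
    rw [hs, abs_div, abs_two] at h1
    have h2 := le_abs_self (Real.exp s - 1)
    linarith
  have hprod : Real.exp (σ₀ / 2) * ‖1 + x‖ = Real.exp (σ₀ / 2 + x.re) * ‖y‖ := by
    rw [hyx, Real.exp_add]; ring
  constructor
  · rw [hprod, hσ', Real.exp_add, mul_assoc]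
    refine mul_le_mul_of_nonneg_left ?_ (Real.exp_pos _).le
    have h1 := hexp (-(η / 2)) (abs_neg _)
    calc _ ≤ (1 + B) * (1 + 3 * ‖x‖ ^ 2) := by gcongr
      _ ≤ _ := by nlinarith
  · rw [hprod, hσ, Real.exp_add (σ₀ / 2 + x.re), mul_assoc]
    refine mul_le_mul_of_nonneg_left ?_ (Real.exp_pos _).le
    have h1 := hexp (η / 2) rfl
    refine h1.trans ?_
    calc 1 + B ≤ (1 - 3 * ‖x‖ ^ 2) * (1 + (6 * ‖x‖ ^ 2 + 2 * B)) := by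
          nlinarith [sq_nonneg ‖x‖]
      _ ≤ _ := by gcongr

/-- A regular curve satisfying the geodesic equation is straight to second order in the normal
holomorphic coordinate. -/
theorem abs_im_normal_coordinate_le {a u c₁ c₂ Γ : ℂ} {Δ A G M K₂ K₃ : ℝ} (ha : (a * c₁).im = 0)
    (hgeo : c₂ + Γ * c₁ ^ 2 = 0) (h3 : ‖u - Δ * c₁ - Δ ^ 2 / 2 * c₂‖ ≤ K₃ * |Δ| ^ 3)
    (h2 : ‖u - Δ * c₁‖ ≤ K₂ * |Δ| ^ 2) (hΔ : |Δ| ≤ 1) (hM : ‖c₁‖ ≤ M) (hG : ‖Γ‖ ≤ G)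
    (hA : ‖a‖ ≤ A) (hK₂ : 0 ≤ K₂) :
    |(a * (u + Γ / 2 * u ^ 2)).im| ≤ A * (K₃ + G / 2 * (K₂ * (2 * M + K₂))) * |Δ| ^ 3 := by
  have hΔ0 := abs_nonneg Δ
  have hM0 : 0 ≤ M := (norm_nonneg _).trans hM
  have hG0 : 0 ≤ G := (norm_nonneg _).trans hG
  have hA0 : 0 ≤ A := (norm_nonneg _).trans hA
  set E := (u - Δ * c₁ - Δ ^ 2 / 2 * c₂) + Γ / 2 * ((u - Δ * c₁) * (u + Δ * c₁)) with hE
  have e1 : a * (u + Γ / 2 * u ^ 2) = (Δ : ℂ) * (a * c₁) + a * E := by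
    have : c₂ = -(Γ * c₁ ^ 2) := eq_neg_of_add_eq_zero_left hgeo
    rw [hE, this]; ring
  have h4 : ‖u + Δ * c₁‖ ≤ (2 * M + K₂) * |Δ| := by
    calc ‖u + Δ * c₁‖ = ‖(u - Δ * c₁) + 2 * Δ * c₁‖ := by ring_nf
      _ ≤ ‖u - Δ * c₁‖ + ‖2 * Δ * c₁‖ := norm_add_le _ _
      _ ≤ K₂ * |Δ| ^ 2 + 2 * |Δ| * M := by
        rw [norm_mul, norm_mul, Complex.norm_real, Real.norm_eq_abs, Complex.norm_ofNat]
        gcongr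
      _ ≤ K₂ * |Δ| + 2 * |Δ| * M := by
        have : |Δ| ^ 2 ≤ |Δ| := by nlinarith
        gcongr
      _ = _ := by ring
  have h5 : ‖E‖ ≤ (K₃ + G / 2 * (K₂ * (2 * M + K₂))) * |Δ| ^ 3 := by
    calc ‖E‖ ≤ ‖u - Δ * c₁ - Δ ^ 2 / 2 * c₂‖ + ‖Γ / 2 * ((u - Δ * c₁) * (u + Δ * c₁))‖ :=
          norm_add_le _ _
      _ ≤ K₃ * |Δ| ^ 3 + G / 2 * ((K₂ * |Δ| ^ 2) * ((2 * M + K₂) * |Δ|)) := by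
        rw [norm_mul, norm_mul, norm_div, Complex.norm_ofNat]
        gcongr
      _ = _ := by ring
  rw [e1, Complex.add_im, Complex.im_ofReal_mul, ha, mul_zero, zero_add]
  refine (Complex.abs_im_le_norm _).trans ?_
  rw [norm_mul, mul_assoc]
  gcongr

theorem norm_sub_le_of_norm_deriv_le_ball_inter {v : ℂ → ℂ} {z₀ : ℂ} {ρ C : ℝ}
    (hvc : ContinuousOn v (closedBall 0 1 ∩ ball z₀ ρ))
    (hvd : DifferentiableOn ℂ v (ball 0 1 ∩ ball z₀ ρ))
    (hC : ∀ z ∈ ball (0 : ℂ) 1 ∩ ball z₀ ρ, ‖deriv v z‖ ≤ C) {z w : ℂ}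
    (hz : z ∈ closedBall (0 : ℂ) 1 ∩ ball z₀ ρ) (hw : w ∈ closedBall (0 : ℂ) 1 ∩ ball z₀ ρ) :
    ‖v z - v w‖ ≤ C * ‖z - w‖ := by
  have hlip : ∀ z ∈ ball (0 : ℂ) 1 ∩ ball z₀ ρ, ∀ w ∈ ball (0 : ℂ) 1 ∩ ball z₀ ρ,
      ‖v z - v w‖ ≤ C * ‖z - w‖ := fun z hz w hw ↦
    ((convex_ball _ _).inter (convex_ball _ _)).norm_image_sub_le_of_norm_deriv_le
      (fun x hx ↦ hvd.differentiableAt ((isOpen_ball.inter isOpen_ball).mem_nhds hx)) hC hw hz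
  have happ : ∀ x ∈ closedBall (0 : ℂ) 1 ∩ ball z₀ ρ,
      Filter.Tendsto (fun s : ℝ ↦ (1 - s : ℂ) * x) (nhdsWithin 0 (Ioi 0))
        (nhdsWithin x (ball (0 : ℂ) 1 ∩ ball z₀ ρ)) := by
    intro x hx
    have h1 : Filter.Tendsto (fun s : ℝ ↦ (1 - s : ℂ) * x) (nhdsWithin 0 (Ioi 0)) (nhds x) := by
      have : Continuous fun s : ℝ ↦ (1 - s : ℂ) * x := by fun_prop
      have h2 := this.tendsto 0
      simp only [Complex.ofReal_zero, sub_zero, one_mul] at h2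
      exact h2.mono_left nhdsWithin_le_nhds
    refine tendsto_nhdsWithin_iff.2 ⟨h1, ?_⟩
    filter_upwards [self_mem_nhdsWithin, nhdsWithin_le_nhds (Iio_mem_nhds (zero_lt_one (α := ℝ))),
      h1.eventually (isOpen_ball.mem_nhds hx.2)] with s hs hs1 hs2
    refine ⟨?_, hs2⟩
    have h3 : ‖(1 - s : ℂ)‖ = 1 - s := by
      rw [← Complex.ofReal_one, ← Complex.ofReal_sub, Complex.norm_real,
        Real.norm_of_nonneg (sub_nonneg.2 (le_of_lt hs1))]
    rw [mem_ball_zero_iff, norm_mul, h3]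
    have h4 := mem_closedBall_zero_iff.1 hx.1
    have h5 : 0 < s := hs
    have h6 : s < 1 := hs1
    nlinarith
  have hvx : ∀ x ∈ closedBall (0 : ℂ) 1 ∩ ball z₀ ρ,
      Filter.Tendsto (fun s : ℝ ↦ v ((1 - s : ℂ) * x)) (nhdsWithin 0 (Ioi 0)) (nhds (v x)) :=
    fun x hx ↦ ((hvc x hx).mono (inter_subset_inter_left _ ball_subset_closedBall)).tendsto.comp
      (happ x hx)
  have t1 := ((hvx z hz).sub (hvx w hw)).norm
  have t2 := ((((happ z hz).mono_right nhdsWithin_le_nhds).sub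
    ((happ w hw).mono_right nhdsWithin_le_nhds)).norm).const_mul C
  refine le_of_tendsto_of_tendsto t1 t2 ?_
  filter_upwards [(happ z hz).eventually self_mem_nhdsWithin,
    (happ w hw).eventually self_mem_nhdsWithin] with s h1 h2
  exact hlip _ h1 _ h2

theorem norm_le_norm_fderiv_of_eq {L : ℂ →L[ℝ] ℝ} {Γ : ℂ} (h : ∀ u, L u = 2 * (Γ * u).re) :
    ‖Γ‖ ≤ ‖L‖ := by
  have h1 := h (starRingEnd ℂ Γ)
  rw [Complex.mul_conj, Complex.normSq_eq_norm_sq, Complex.ofReal_re] at h1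
  have h2 := L.le_opNorm (starRingEnd ℂ Γ)
  rw [h1, Complex.norm_conj, Real.norm_of_nonneg (by positivity)] at h2
  by_contra! hlt
  have : 0 < ‖Γ‖ := (norm_nonneg _).trans_lt hlt
  nlinarith

set_option maxHeartbeats 1600000 in
/-- Boundary improvement: if the metric derivative of a holomorphic map with boundary on a
geodesic is bounded by `Λ`, it is bounded by a smaller constant near the boundary. -/
theorem exists_improved_bound {v : ℂ → ℂ} {σ : ℂ → ℝ} {Γ : ℂ → ℂ} {c : ℝ → ℂ} {z₀ : ℂ}
    {t₀ ρ Λ : ℝ} (hz₀ : ‖z₀‖ = 1)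
    (hρ : 0 < ρ) (hvc : ContinuousOn v (closedBall 0 1 ∩ ball z₀ ρ))
    (hvd : DifferentiableOn ℂ v (ball 0 1 ∩ ball z₀ ρ)) (hc : ContDiffAt ℝ 3 c t₀)
    (h0 : deriv c t₀ ≠ 0)
    (hbd : ∀ ε > 0, ∀ᶠ z in nhdsWithin z₀ (sphere 0 1), ∃ t ∈ ball t₀ ε, v z = c t)
    (hσ : ContDiffAt ℝ 2 σ (v z₀)) (hΓ : ∀ w u, fderiv ℝ σ w u = 2 * (Γ w * u).re)
    (hgeo : ∀ᶠ t in nhds t₀, deriv (deriv c) t + Γ (c t) * (deriv c t) ^ 2 = 0) (hΛ : 0 < Λ)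
    (hN : ∀ z ∈ ball (0 : ℂ) 1 ∩ ball z₀ ρ, Real.exp (σ (v z) / 2) * ‖deriv v z‖ ≤ Λ) :
    ∃ Λ' < Λ, ∃ r > 0, ∀ z ∈ ball (0 : ℂ) 1 ∩ ball z₀ r,
      Real.exp (σ (v z) / 2) * ‖deriv v z‖ ≤ Λ' := by
  set w₀ := v z₀ with hw₀
  set s₀ := σ w₀ with hs₀
  -- constants for the metric
  obtain ⟨Kσ, hKσ, εσ, hεσ, hTσ⟩ := hσ.exists_taylor_two
  set G : ℝ := ‖fderiv ℝ σ w₀‖ + 1 with hG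
  have hG0 : 0 < G := by positivity
  have hevσ : ∀ᶠ w in nhds w₀, |σ w - s₀| ≤ 1 ∧ ‖Γ w‖ ≤ G := by
    have h1 : ContinuousAt (fun w ↦ |σ w - s₀|) w₀ := (hσ.continuousAt.sub continuousAt_const).abs
    have h2 : ContinuousAt (fun w ↦ ‖fderiv ℝ σ w‖) w₀ :=
      (hσ.fderiv_right (m := 1) (by norm_num)).continuousAt.norm
    have h0 : |σ w₀ - s₀| < 1 := by rw [sub_self, abs_zero]; exact one_pos
    filter_upwards [h1.eventually (gt_mem_nhds h0),
      h2.eventually (gt_mem_nhds (show ‖fderiv ℝ σ w₀‖ < G by linarith))] with w h3 h4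
    exact ⟨h3.le, (norm_le_norm_fderiv_of_eq (hΓ w)).trans h4.le⟩
  obtain ⟨εσ', hεσ', hballσ⟩ := Metric.mem_nhds_iff.1 hevσ
  set εw := min εσ εσ' with hεw
  have hεw0 : 0 < εw := by positivity
  -- constants for the curve
  obtain ⟨K₃, hK₃, ε₃, hε₃, hT₃⟩ := hc.exists_taylor_three_real
  obtain ⟨K₂, hK₂, ε₂, hε₂, hT₂⟩ := (hc.of_le (m := 2) (by norm_num)).exists_taylor_two_real
  set m := ‖deriv c t₀‖ / 2 with hm
  have hm0 : 0 < m := by have := norm_pos_iff.2 h0; positivity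
  set M := ‖deriv c t₀‖ + 1 with hM
  have hM0 : 0 < M := by positivity
  have hevt : ∀ᶠ t in nhds t₀, (deriv (deriv c) t + Γ (c t) * (deriv c t) ^ 2 = 0) ∧
      m ≤ ‖deriv c t‖ ∧ ‖deriv c t‖ ≤ M := by
    have h1 : ContinuousAt (fun t ↦ ‖deriv c t‖) t₀ :=
      (hc.derivWithin (m := 2) (by norm_num)).continuousAt.norm
    filter_upwards [hgeo, h1.eventually (lt_mem_nhds (show m < ‖deriv c t₀‖ by linarith [norm_pos_iff.2 h0])),
      h1.eventually (gt_mem_nhds (show ‖deriv c t₀‖ < M by linarith))] with t h2 h3 h4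
    exact ⟨h2, h3.le, h4.le⟩
  obtain ⟨ε₁, hε₁, hballt⟩ := Metric.mem_nhds_iff.1 hevt
  set ε := min (min ε₁ (min ε₂ ε₃)) (min (1 / 2) (m / (4 * K₂))) with hε
  have hε0 : 0 < ε := by positivity
  have hεε₁ : ball t₀ ε ⊆ ball t₀ ε₁ :=
    ball_subset_ball ((min_le_left _ _).trans (min_le_left _ _))
  have hεε₂ : ball t₀ ε ⊆ ball t₀ ε₂ :=
    ball_subset_ball ((min_le_left _ _).trans ((min_le_right _ _).trans (min_le_left _ _)))
  have hεε₃ : ball t₀ ε ⊆ ball t₀ ε₃ :=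
    ball_subset_ball ((min_le_left _ _).trans ((min_le_right _ _).trans (min_le_right _ _)))
  have hεhalf : ε ≤ 1 / 2 := (min_le_right _ _).trans (min_le_left _ _)
  have hεm : K₂ * (2 * ε) ≤ m / 2 := by
    calc K₂ * (2 * ε) ≤ K₂ * (2 * (m / (4 * K₂))) := by
          gcongr; exact (min_le_right _ _).trans (min_le_right _ _)
      _ = m / 2 := by field_simp; norm_num
  have hΔlt : ∀ s ∈ ball t₀ ε, ∀ t ∈ ball t₀ ε, |t - s| ≤ 2 * ε := by
    intro s hs t ht
    have := dist_triangle_right t s t₀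
    rw [Real.dist_eq] at this
    rw [mem_ball] at hs ht
    linarith
  have hΔ : ∀ s ∈ ball t₀ ε, ∀ t ∈ ball t₀ ε, |t - s| ≤ 2 / m * ‖c t - c s‖ := by
    intro s hs t ht
    have h1 := hT₂ s (hεε₂ hs) t (hεε₂ ht)
    have h2 := (hballt (hεε₁ hs)).2.1
    have h3 := norm_sub_norm_le ((t - s) * deriv c s : ℂ) (c t - c s)
    rw [norm_sub_rev ((t - s) * deriv c s : ℂ) (c t - c s)] at h3
    have h4 : ‖((t - s) * deriv c s : ℂ)‖ = |t - s| * ‖deriv c s‖ := by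
      rw [norm_mul, ← Complex.ofReal_sub, Complex.norm_real, Real.norm_eq_abs]
    rw [h4] at h3
    have h5 : K₂ * |t - s| ^ 2 ≤ m / 2 * |t - s| := by
      calc K₂ * |t - s| ^ 2 = K₂ * |t - s| * |t - s| := by ring
        _ ≤ K₂ * (2 * ε) * |t - s| := by gcongr; exact hΔlt s hs t ht
        _ ≤ m / 2 * |t - s| := by gcongr
    have h6 : m * |t - s| ≤ |t - s| * ‖deriv c s‖ := by
      rw [mul_comm]; gcongr
    rw [div_mul_eq_mul_div, le_div_iff₀ hm0]
    linarith
  -- Lipschitz constant and the neighbourhood of the boundary point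
  set C : ℝ := Λ * Real.exp (-((s₀ - 1) / 2)) with hC
  have hC0 : 0 < C := by positivity
  have hvt : Filter.Tendsto v (nhdsWithin z₀ (closedBall 0 1)) (nhds w₀) :=
    (hvc z₀ ⟨by simp [hz₀], mem_ball_self hρ⟩).mono_of_mem_nhdsWithin
      (Filter.inter_mem self_mem_nhdsWithin (mem_nhdsWithin_of_mem_nhds (ball_mem_nhds z₀ hρ)))
  obtain ⟨ρ₁, hρ₁, hball₁⟩ := Metric.mem_nhdsWithin_iff.1
    (hvt.eventually (ball_mem_nhds w₀ hεw0))
  obtain ⟨ρ₂, hρ₂, hball₂⟩ := Metric.mem_nhdsWithin_iff.1 (hbd ε hε0)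
  set B : ℝ := C * (3 * G + 1 + Kσ) with hB
  have hB0 : 0 < B := by positivity
  set δ := min (min (ρ / 2) (min (ρ₁ / 2) (ρ₂ / 2))) (min 1 (1 / B)) with hδ
  have hδ0 : 0 < δ := by positivity
  have hδρ : 2 * δ ≤ ρ := by
    have : δ ≤ ρ / 2 := (min_le_left _ _).trans (min_le_left _ _)
    linarith
  have hδρ₁ : 2 * δ ≤ ρ₁ := by
    have : δ ≤ ρ₁ / 2 := (min_le_left _ _).trans ((min_le_right _ _).trans (min_le_left _ _))
    linarith
  have hδρ₂ : 2 * δ ≤ ρ₂ := by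
    have : δ ≤ ρ₂ / 2 := (min_le_left _ _).trans ((min_le_right _ _).trans (min_le_right _ _))
    linarith
  have hδ1 : δ ≤ 1 := (min_le_right _ _).trans (min_le_left _ _)
  have hδB : B * δ ≤ 1 := by
    calc B * δ ≤ B * (1 / B) := by gcongr; exact (min_le_right _ _).trans (min_le_right _ _)
      _ = 1 := by field_simp
  have hVn : ∀ z ∈ closedBall (0 : ℂ) 1 ∩ ball z₀ (2 * δ), v z ∈ ball w₀ εw := fun z hz ↦
    hball₁ ⟨ball_subset_ball hδρ₁ hz.2, hz.1⟩
  have hVS : ∀ z ∈ closedBall (0 : ℂ) 1 ∩ ball z₀ (2 * δ), |σ (v z) - s₀| ≤ 1 ∧ ‖Γ (v z)‖ ≤ G :=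
    fun z hz ↦ hballσ (ball_subset_ball (min_le_right _ _) (hVn z hz))
  have hsubρ : ball z₀ (2 * δ) ⊆ ball z₀ ρ := ball_subset_ball hδρ
  have hvc' := hvc.mono (inter_subset_inter_right (closedBall 0 1) hsubρ)
  have hvd' := hvd.mono (inter_subset_inter_right (ball 0 1) hsubρ)
  have hlip : ∀ z ∈ closedBall (0 : ℂ) 1 ∩ ball z₀ (2 * δ),
      ∀ w ∈ closedBall (0 : ℂ) 1 ∩ ball z₀ (2 * δ), ‖v z - v w‖ ≤ C * ‖z - w‖ := by
    intro z hz w hw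
    refine norm_sub_le_of_norm_deriv_le_ball_inter hvc' hvd' (fun x hx ↦ ?_) hz hw
    have h1 := hN x ⟨hx.1, hsubρ hx.2⟩
    have h2 := (abs_le.1 (hVS x ⟨ball_subset_closedBall hx.1, hx.2⟩).1).1
    rw [hC, Real.exp_neg, ← div_eq_mul_inv, le_div_iff₀ (Real.exp_pos _), mul_comm]
    refine le_trans ?_ h1
    gcongr
    linarith
  set K₁ : ℝ := 6 * G ^ 2 + 2 * Kσ with hK₁
  set A : ℝ := Real.exp ((s₀ + 1) / 2) with hA
  set Kb : ℝ := A * (K₃ + G / 2 * (K₂ * (2 * M + K₂))) * (2 / m * C) ^ 3 with hKb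
  set K : ℝ := K₁ * C ^ 2 + Kb with hK
  have hK₁0 : 0 < K₁ := by positivity
  have hKb0 : 0 < Kb := by positivity
  have hK0 : 0 < K := by positivity
  obtain ⟨Λ₀, hΛ₀, d₀, hd₀, hS⟩ := exists_norm_deriv_le_of_real_on_sphere hΛ hK0 hδ0 hδ1
  set r : ℝ := min (min (δ / 2) d₀) ((Λ - Λ₀) / (2 * Λ * K)) with hr
  have hr0 : 0 < r := by
    have : 0 < Λ - Λ₀ := sub_pos.2 hΛ₀
    positivity
  have hrδ : r ≤ δ / 2 := (min_le_left _ _).trans (min_le_left _ _)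
  have hrd₀ : r ≤ d₀ := (min_le_left _ _).trans (min_le_right _ _)
  refine ⟨(Λ + Λ₀) / 2, by linarith, r, hr0, fun z hz ↦ ?_⟩
  have hz1 : ‖z‖ < 1 := mem_ball_zero_iff.1 hz.1
  have hzz₀ : ‖z - z₀‖ < r := mem_ball_iff_norm.1 hz.2
  have hd : 1 - ‖z‖ ≤ ‖z - z₀‖ := by
    have := norm_sub_norm_le z₀ z
    rw [norm_sub_rev, hz₀] at this
    exact this
  set d := 1 - ‖z‖ with hdd
  have hdpos : 0 < d := by linarith
  have hzne : z ≠ 0 := by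
    rintro rfl
    simp at hdd
    linarith
  set z₁ := z / ‖z‖ with hz₁
  have hz₁n : ‖z₁‖ = 1 := Complex.norm_div_norm_self hzne
  have hzz₁ : ‖z - z₁‖ = d := Complex.norm_sub_div_norm hzne hz1.le
  have hsub : ball z₁ δ ⊆ ball z₀ (2 * δ) := by
    intro w hw
    rw [mem_ball_iff_norm] at *
    have h1 : ‖w - z₀‖ ≤ ‖w - z₁‖ + ‖z - z₁‖ + ‖z - z₀‖ := by
      rw [norm_sub_rev z z₁]
      calc ‖w - z₀‖ = ‖(w - z₁) + (z₁ - z) + (z - z₀)‖ := by ring_nf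
        _ ≤ _ := norm_add₃_le
    linarith
  have hz₁mem : z₁ ∈ closedBall (0 : ℂ) 1 ∩ ball z₀ (2 * δ) :=
    ⟨by simp [hz₁n], hsub (mem_ball_self hδ0)⟩
  obtain ⟨t₁, ht₁, hvt₁⟩ := hball₂ ⟨ball_subset_ball hδρ₂ hz₁mem.2, by simp [hz₁n]⟩
  obtain ⟨hgeo₁, hm₁, hM₁⟩ := hballt (hεε₁ ht₁)
  set c₁ := deriv c t₁ with hc₁
  have hc₁ne : (‖c₁‖ : ℂ) ≠ 0 := by exact_mod_cast (hm0.trans_le hm₁).ne'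
  set Γ₁ := Γ (v z₁) with hΓ₁
  set a : ℂ := Real.exp (σ (v z₁) / 2) * (starRingEnd ℂ c₁ / ‖c₁‖) with ha
  have han : ‖a‖ = Real.exp (σ (v z₁) / 2) := by
    rw [ha, norm_mul, norm_div, Complex.norm_conj, Complex.norm_real, Complex.norm_real, norm_norm,
      div_self (hm0.trans_le hm₁).ne', mul_one, Real.norm_of_nonneg (Real.exp_pos _).le]
  have hac : (a * c₁).im = 0 := by
    have : a * c₁ = ((Real.exp (σ (v z₁) / 2) * ‖c₁‖ : ℝ) : ℂ) := by
      rw [ha, mul_assoc, div_mul_eq_mul_div, mul_comm (starRingEnd ℂ c₁), Complex.mul_conj,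
        Complex.normSq_eq_norm_sq]
      push_cast
      field_simp
    rw [this, Complex.ofReal_im]
  set F : ℂ → ℂ := fun x ↦ a * ((v x - v z₁) + Γ₁ / 2 * (v x - v z₁) ^ 2) with hF
  have hmemδ : ∀ {x}, x ∈ closedBall (0 : ℂ) 1 ∩ ball z₁ δ →
      x ∈ closedBall (0 : ℂ) 1 ∩ ball z₀ (2 * δ) := fun hx ↦ ⟨hx.1, hsub hx.2⟩
  have hcmp : ∀ x ∈ ball (0 : ℂ) 1 ∩ ball z₁ δ,
      ‖deriv F x‖ ≤ Real.exp (σ (v x) / 2) * ‖deriv v x‖ * (1 + K₁ * C ^ 2 * ‖x - z₁‖ ^ 2) ∧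
      Real.exp (σ (v x) / 2) * ‖deriv v x‖ ≤ ‖deriv F x‖ * (1 + K₁ * C ^ 2 * ‖x - z₁‖ ^ 2) := by
    intro x hx
    have hxc : x ∈ closedBall (0 : ℂ) 1 ∩ ball z₁ δ := ⟨ball_subset_closedBall hx.1, hx.2⟩
    have hvx := (hvd'.differentiableAt ((isOpen_ball.inter isOpen_ball).mem_nhds
      ⟨hx.1, hsub hx.2⟩)).hasDerivAt
    have hFx : deriv F x = a * (1 + Γ₁ * (v x - v z₁)) * deriv v x := by
      have e1 := hvx.sub_const (v z₁)
      rw [hF, ((e1.fun_add ((e1.fun_pow 2).const_mul (Γ₁ / 2))).const_mul a).deriv]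
      push_cast; ring
    have hl := hlip x (hmemδ hxc) z₁ hz₁mem
    have hxδ : ‖x - z₁‖ < δ := mem_ball_iff_norm.1 hx.2
    set h := ‖v x - v z₁‖ with hh
    have hh0 : 0 ≤ h := norm_nonneg _
    have hhδ : h ≤ C * δ := hl.trans (by gcongr)
    have hBe : C * δ * (3 * G + 1 + Kσ) ≤ 1 := by
      calc C * δ * (3 * G + 1 + Kσ) = B * δ := by rw [hB]; ring
        _ ≤ 1 := hδB
    have hCδ : 0 < C * δ := by positivity
    have hGh : ‖Γ₁ * (v x - v z₁)‖ ≤ G * h := by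
      rw [norm_mul]
      gcongr
      exact (hVS z₁ hz₁mem).2
    have hGh3 : G * h ≤ 1 / 3 := by
      have : G * h ≤ G * (C * δ) := by gcongr
      linarith [mul_pos hCδ hKσ]
    have hKh : Kσ * h ^ 2 ≤ 1 := by
      have h1 : h ≤ 1 := by linarith [mul_pos hCδ hKσ, mul_pos hCδ hG0]
      have h2 : Kσ * h ≤ 1 := by
        have : Kσ * h ≤ Kσ * (C * δ) := by gcongr
        linarith [mul_pos hCδ hG0]
      calc Kσ * h ^ 2 = (Kσ * h) * h := by ring
        _ ≤ 1 * 1 := by gcongr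
        _ = 1 := one_mul _
    have hTx := hTσ (v z₁) (ball_subset_ball (min_le_left _ _) (hVn z₁ hz₁mem)) (v x)
      (ball_subset_ball (min_le_left _ _) (hVn x (hmemδ hxc)))
    rw [hΓ, Real.norm_eq_abs, ← hΓ₁, ← hh] at hTx
    obtain ⟨q1, q2⟩ := exp_half_mul_norm_one_add_le (hGh.trans hGh3) hTx hKh
    have hfac : 1 + (6 * ‖Γ₁ * (v x - v z₁)‖ ^ 2 + 2 * (Kσ * h ^ 2)) ≤
        1 + K₁ * C ^ 2 * ‖x - z₁‖ ^ 2 := by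
      have h1 : ‖Γ₁ * (v x - v z₁)‖ ^ 2 ≤ (G * h) ^ 2 := by gcongr
      have h2 : h ^ 2 ≤ (C * ‖x - z₁‖) ^ 2 := by gcongr
      have h3 : K₁ * h ^ 2 ≤ K₁ * (C * ‖x - z₁‖) ^ 2 := by gcongr
      calc _ ≤ 1 + (6 * (G * h) ^ 2 + 2 * (Kσ * h ^ 2)) := by gcongr
        _ = 1 + K₁ * h ^ 2 := by rw [hK₁]; ring
        _ ≤ 1 + K₁ * (C * ‖x - z₁‖) ^ 2 := by gcongr
        _ = _ := by ring
    have hFn : ‖deriv F x‖ = Real.exp (σ (v z₁) / 2) * ‖1 + Γ₁ * (v x - v z₁)‖ * ‖deriv v x‖ := by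
      rw [hFx, norm_mul, norm_mul, han]
    rw [hFn]
    constructor
    · calc _ ≤ Real.exp (σ (v x) / 2) * (1 + K₁ * C ^ 2 * ‖x - z₁‖ ^ 2) * ‖deriv v x‖ := by
            refine mul_le_mul_of_nonneg_right (q1.trans ?_) (norm_nonneg _)
            gcongr
        _ = _ := by ring
    · calc _ ≤ Real.exp (σ (v z₁) / 2) * ‖1 + Γ₁ * (v x - v z₁)‖ *
            (1 + K₁ * C ^ 2 * ‖x - z₁‖ ^ 2) * ‖deriv v x‖ := by
            gcongr
            exact q2.trans (by gcongr)
        _ = _ := by ring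
  have hFd : DifferentiableOn ℂ F (ball 0 1 ∩ ball z₁ δ) := by
    have h1 : DifferentiableOn ℂ (fun x ↦ v x - v z₁) (ball 0 1 ∩ ball z₁ δ) :=
      (hvd'.mono (inter_subset_inter_right _ hsub)).sub_const _
    exact (h1.add ((h1.pow 2).const_mul _)).const_mul _
  have hFc : ContinuousOn F (closedBall 0 1 ∩ ball z₁ δ) := by
    have h1 : ContinuousOn (fun x ↦ v x - v z₁) (closedBall 0 1 ∩ ball z₁ δ) :=
      (hvc'.mono (inter_subset_inter_right _ hsub)).sub continuousOn_const
    exact continuousOn_const.mul (h1.add (continuousOn_const.mul (h1.pow 2)))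
  have hres := hS z₁ F hz₁n hFd hFc (fun x hx ↦ ?_) (fun x hx ↦ ?_) d hdpos
    ((hd.trans_lt hzz₀).trans_le hrd₀)
  · have hzeq : z₁ * (1 - (d : ℂ)) = z := by
      rw [hz₁, hdd]
      have : (‖z‖ : ℂ) ≠ 0 := by simpa using hzne
      push_cast
      field_simp
      ring
    rw [hzeq] at hres
    have hΛ₀0 : 0 ≤ Λ₀ := (norm_nonneg _).trans hres
    have hfin := (hcmp z ⟨hz.1, by rw [mem_ball_iff_norm, hzz₁]; linarith⟩).2
    rw [hzz₁] at hfin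
    refine hfin.trans ?_
    have hd1 : d ≤ 1 := by linarith
    have hdr : d ≤ (Λ - Λ₀) / (2 * Λ * K) := (hd.trans hzz₀.le).trans (min_le_right _ _)
    have h1 : K₁ * C ^ 2 * d ^ 2 ≤ K * d := by
      have h2 : d ^ 2 ≤ d := by nlinarith
      have h3 : K₁ * C ^ 2 ≤ K := by linarith
      calc K₁ * C ^ 2 * d ^ 2 ≤ K * d ^ 2 := by gcongr
        _ ≤ K * d := by gcongr
    have h4 : Λ * K * d ≤ (Λ - Λ₀) / 2 := by
      calc Λ * K * d ≤ Λ * K * ((Λ - Λ₀) / (2 * Λ * K)) := by gcongr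
        _ = (Λ - Λ₀) / 2 := by field_simp
    calc ‖deriv F z‖ * (1 + K₁ * C ^ 2 * d ^ 2) ≤ Λ₀ * (1 + K * d) := by gcongr
      _ = Λ₀ + Λ₀ * (K * d) := by ring
      _ ≤ Λ₀ + Λ * (K * d) := by gcongr
      _ ≤ (Λ + Λ₀) / 2 := by linarith
  · refine (hcmp x hx).1.trans ?_
    have h1 : K₁ * C ^ 2 ≤ K := by linarith
    have h2 := hN x ⟨hx.1, hsubρ (hsub hx.2)⟩
    gcongr
  · have hxc : x ∈ closedBall (0 : ℂ) 1 ∩ ball z₁ δ := ⟨sphere_subset_closedBall hx.1, hx.2⟩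
    obtain ⟨t, ht, hvx⟩ := hball₂ ⟨ball_subset_ball hδρ₂ (hsub hx.2), hx.1⟩
    have h1 := abs_im_normal_coordinate_le (u := v x - v z₁) (Δ := t - t₁) (Γ := Γ₁) (A := A)
      (G := G) (M := M) (K₂ := K₂) (K₃ := K₃) (c₂ := deriv (deriv c) t₁) hac
      (by rw [hΓ₁, hvt₁]; exact hgeo₁)
      (by
        rw [hvx, hvt₁]
        push_cast
        exact hT₃ t₁ (hεε₃ ht₁) t (hεε₃ ht))
      (by
        rw [hvx, hvt₁]
        push_cast
        exact hT₂ t₁ (hεε₂ ht₁) t (hεε₂ ht))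
      ((hΔlt t₁ ht₁ t ht).trans (by linarith)) hM₁ (hVS z₁ hz₁mem).2
      (by
        rw [han, hA]
        gcongr
        linarith [(abs_le.1 (hVS z₁ hz₁mem).1).2]) hK₂.le
    refine h1.trans ?_
    have h2 : |t - t₁| ≤ 2 / m * C * ‖x - z₁‖ := by
      refine (hΔ t₁ ht₁ t ht).trans ?_
      rw [mul_assoc]
      gcongr
      rw [← hvx, ← hvt₁]
      exact hlip x (hmemδ hxc) z₁ hz₁mem
    calc _ ≤ A * (K₃ + G / 2 * (K₂ * (2 * M + K₂))) * (2 / m * C * ‖x - z₁‖) ^ 3 := by gcongr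
      _ = Kb * ‖x - z₁‖ ^ 3 := by rw [hKb]; ring
      _ ≤ K * ‖x - z₁‖ ^ 3 := by
        gcongr
        have : 0 ≤ K₁ * C ^ 2 := by positivity
        linarith

/-- Local bounds on the unit disc near each boundary point give a uniform bound near the
boundary. -/
theorem exists_bound_near_sphere {N : ℂ → ℝ} {p : ℝ → Prop} (hp : ∀ a b, p a → p b → p (max a b))
    (h : ∀ z₀ ∈ sphere (0 : ℂ) 1, ∃ C, p C ∧ ∃ r > 0, ∀ z ∈ ball (0 : ℂ) 1 ∩ ball z₀ r, N z ≤ C) :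
    ∃ C, p C ∧ ∃ R < 1, ∀ z ∈ ball (0 : ℂ) 1, R < ‖z‖ → N z ≤ C := by
  obtain ⟨C, hC, U, hU, hSU, hb⟩ : ∃ C, p C ∧ ∃ U, IsOpen U ∧ sphere (0 : ℂ) 1 ⊆ U ∧
      ∀ z ∈ ball (0 : ℂ) 1 ∩ U, N z ≤ C := by
    refine (isCompact_sphere (0 : ℂ) 1).induction_on
      (p := fun s ↦ ∃ C, p C ∧ ∃ U, IsOpen U ∧ s ⊆ U ∧ ∀ z ∈ ball (0 : ℂ) 1 ∩ U, N z ≤ C)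
      ?_ ?_ ?_ ?_
    · obtain ⟨C, hC, -⟩ := h 1 (by simp)
      exact ⟨C, hC, ∅, isOpen_empty, subset_rfl, by simp⟩
    · rintro s t hst ⟨C, hC, U, hU, hs, hb⟩
      exact ⟨C, hC, U, hU, hst.trans hs, hb⟩
    · rintro s t ⟨C, hC, U, hU, hs, hb⟩ ⟨D, hD, V, hV, ht, hb'⟩
      refine ⟨max C D, hp C D hC hD, U ∪ V, hU.union hV, union_subset_union hs ht, ?_⟩
      rintro z ⟨hz, hz' | hz'⟩
      · exact (hb z ⟨hz, hz'⟩).trans (le_max_left _ _)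
      · exact (hb' z ⟨hz, hz'⟩).trans (le_max_right _ _)
    · intro z₀ hz₀
      obtain ⟨C, hC, r, hr, hb⟩ := h z₀ hz₀
      exact ⟨ball z₀ r, mem_nhdsWithin_of_mem_nhds (ball_mem_nhds _ hr), C, hC, ball z₀ r,
        isOpen_ball, subset_rfl, hb⟩
  obtain ⟨δ, hδ, hδU⟩ := (isCompact_sphere (0 : ℂ) 1).exists_thickening_subset_open hU hSU
  refine ⟨C, hC, max 0 (1 - δ), max_lt one_pos (by linarith), fun z hz hRz ↦ hb z ⟨hz, hδU ?_⟩⟩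
  obtain ⟨hz0, hz1⟩ := max_lt_iff.1 hRz
  have hne : z ≠ 0 := norm_pos_iff.1 hz0
  refine mem_thickening_iff.2 ⟨z / ‖z‖, mem_sphere_zero_iff_norm.2 (Complex.norm_div_norm_self hne), ?_⟩
  rw [dist_eq_norm, Complex.norm_sub_div_norm hne (mem_ball_zero_iff.1 hz).le]
  linarith

theorem UnitAddCircle.eventually_exists_lift {τ : ℂ → UnitAddCircle} {s : Set ℂ} {z₀ : ℂ} {t₀ : ℝ}
    (hτ : ContinuousWithinAt τ s z₀) (ht₀ : (t₀ : UnitAddCircle) = τ z₀) {ε : ℝ} (hε : 0 < ε) :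
    ∀ᶠ z in nhdsWithin z₀ s, ∃ t ∈ ball t₀ ε, (t : UnitAddCircle) = τ z := by
  have h1 : IsOpenMap ((↑) : ℝ → UnitAddCircle) := QuotientAddGroup.isOpenMap_coe
  have h2 := h1.image_mem_nhds (ball_mem_nhds t₀ hε)
  rw [ht₀] at h2
  exact hτ h2

theorem exists_ball_subset_chart_source {S : Type*} [TopologicalSpace S] [ChartedSpace ℂ S]
    {f : ℂ → S} {z₀ : ℂ} (hfc : ContinuousOn f (closedBall 0 1)) (hz₀ : z₀ ∈ sphere (0 : ℂ) 1) :
    ∃ ρ > 0, ∀ z ∈ closedBall (0 : ℂ) 1 ∩ ball z₀ ρ, f z ∈ (chartAt ℂ (f z₀)).source := by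
  obtain ⟨ρ, hρ, h⟩ := Metric.mem_nhdsWithin_iff.1
    (hfc z₀ (sphere_subset_closedBall hz₀) ((chartAt ℂ (f z₀)).open_source.mem_nhds
      (mem_chart_source ℂ (f z₀))))
  exact ⟨ρ, hρ, fun z hz ↦ h hz.symm⟩

theorem eventually_chart_eq_on_sphere {S : Type*} [TopologicalSpace S] {γ : UnitAddCircle → S}
    {f : ℂ → S} {τ : ℂ → UnitAddCircle} {z₀ : ℂ} (hτ : ContinuousOn τ (sphere 0 1))
    (hfτ : ∀ z ∈ sphere (0 : ℂ) 1, f z = γ (τ z)) (hz₀ : z₀ ∈ sphere (0 : ℂ) 1)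
    (φ : OpenPartialHomeomorph S ℂ) {t₀ : ℝ} (ht₀ : (t₀ : UnitAddCircle) = τ z₀) {ε : ℝ}
    (hε : 0 < ε) :
    ∀ᶠ z in nhdsWithin z₀ (sphere 0 1), ∃ t ∈ ball t₀ ε, φ (f z) = φ (γ (t : ℝ)) := by
  filter_upwards [UnitAddCircle.eventually_exists_lift (hτ z₀ hz₀) ht₀ hε, self_mem_nhdsWithin]
    with z ⟨t, ht, htz⟩ hz
  exact ⟨t, ht, by rw [hfτ z hz, htz]⟩

namespace KahlerMetric

variable {S : Type*} [TopologicalSpace S] [ChartedSpace ℂ S] [IsManifold 𝓘(ℂ) ω S]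

theorem exp_half_logDensity_mul_norm_deriv (g : KahlerMetric S) {f : ℂ → S} {z : ℂ}
    (hf : MDifferentiableAt 𝓘(ℂ) 𝓘(ℂ) f z) {φ : OpenPartialHomeomorph S ℂ} (hφ : φ ∈ atlas ℂ S)
    (hz : f z ∈ φ.source) :
    Real.exp (g.logDensity φ (φ (f z)) / 2) * ‖deriv (fun x ↦ φ (f x)) z‖ =
      √(g.normDerivSq f z) := by
  have hpos := g.density_pos hφ (φ.map_source hz)
  rw [g.normDerivSq_eq hφ hf.continuousAt hz (differentiableAt_chart_comp hf hφ hz),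
    Real.sqrt_mul hpos.le, Real.sqrt_sq (norm_nonneg _), logDensity, Real.exp_half,
    Real.exp_log hpos]

section Boundary

variable {g : KahlerMetric S} {γ : UnitAddCircle → S} {f : ℂ → S} {τ : ℂ → UnitAddCircle} {z₀ : ℂ}

theorem exists_normDerivSq_bound_near (hγ : g.IsClosedGeodesic γ)
    (hfc : ContinuousOn f (closedBall 0 1)) (hfd : MDifferentiableOn 𝓘(ℂ) 𝓘(ℂ) f (ball 0 1))
    (hτ : ContinuousOn τ (sphere 0 1)) (hfτ : ∀ z ∈ sphere (0 : ℂ) 1, f z = γ (τ z))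
    (hz₀ : z₀ ∈ sphere (0 : ℂ) 1) :
    ∃ C, ∃ r > 0, ∀ z ∈ ball (0 : ℂ) 1 ∩ ball z₀ r, g.normDerivSq f z ≤ C := by
  obtain ⟨ρ, hρ, hsrc⟩ := exists_ball_subset_chart_source hfc hz₀
  set φ := chartAt ℂ (f z₀) with hφd
  have hφ : φ ∈ atlas ℂ S := chart_mem_atlas ℂ _
  obtain ⟨t₀, ht₀⟩ := QuotientAddGroup.mk_surjective (τ z₀)
  replace ht₀ : (t₀ : UnitAddCircle) = τ z₀ := ht₀
  have hz₀n : ‖z₀‖ = 1 := mem_sphere_zero_iff_norm.1 hz₀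
  have hz₀m : z₀ ∈ closedBall (0 : ℂ) 1 ∩ ball z₀ ρ :=
    ⟨sphere_subset_closedBall hz₀, mem_ball_self hρ⟩
  have hγz : γ t₀ = f z₀ := by rw [ht₀, hfτ z₀ hz₀]
  have hts : γ t₀ ∈ φ.source := hγz ▸ mem_chart_source ℂ (f z₀)
  have hvc : ContinuousOn (fun z ↦ φ (f z)) (closedBall 0 1 ∩ ball z₀ ρ) :=
    φ.continuousOn.comp (hfc.mono inter_subset_left) hsrc
  have hmd : ∀ z ∈ ball (0 : ℂ) 1, MDifferentiableAt 𝓘(ℂ) 𝓘(ℂ) f z := fun z hz ↦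
    hfd.mdifferentiableAt (isOpen_ball.mem_nhds hz)
  have hsrc' : ∀ z ∈ ball (0 : ℂ) 1 ∩ ball z₀ ρ, f z ∈ φ.source := fun z hz ↦
    hsrc z ⟨ball_subset_closedBall hz.1, hz.2⟩
  have hvd : DifferentiableOn ℂ (fun z ↦ φ (f z)) (ball 0 1 ∩ ball z₀ ρ) := fun z hz ↦
    (differentiableAt_chart_comp (hmd z hz.1) hφ (hsrc' z hz)).differentiableWithinAt
  obtain ⟨C, hC, r, hr, hb⟩ := exists_norm_deriv_bound hz₀n hρ hvc hvd
    ((contDiffAt_chart_curve hγ.1.1 hφ hts).of_le (m := 2) (WithTop.coe_le_coe.2 le_top))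
    (by simp [hγz]) (hγ.deriv_ne_zero hφ hts)
    (fun ε hε ↦ eventually_chart_eq_on_sphere hτ hfτ hz₀ φ ht₀ hε)
  have hd : ContinuousWithinAt (fun z ↦ g.density φ (φ (f z))) (closedBall 0 1 ∩ ball z₀ ρ) z₀ := by
    refine ContinuousAt.comp_continuousWithinAt (g := g.density φ) (f := fun z ↦ φ (f z)) ?_ (hvc z₀ hz₀m)
    exact (g.contDiffOn_density hφ).continuousOn.continuousAt
      (φ.open_target.mem_nhds (φ.map_source (hsrc z₀ hz₀m)))
  obtain ⟨r', hr', hb'⟩ := Metric.mem_nhdsWithin_iff.1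
    (hd.eventually (gt_mem_nhds (lt_add_one (g.density φ (φ (f z₀))))))
  set D := g.density φ (φ (f z₀)) + 1
  refine ⟨D * C ^ 2, min ρ (min r r'), by positivity, fun z hz ↦ ?_⟩
  have hzρ : z ∈ ball z₀ ρ := ball_subset_ball (min_le_left _ _) hz.2
  have hzr : z ∈ ball z₀ r := ball_subset_ball ((min_le_right _ _).trans (min_le_left _ _)) hz.2
  have hzr' : z ∈ ball z₀ r' := ball_subset_ball ((min_le_right _ _).trans (min_le_right _ _)) hz.2
  have hs := hsrc' z ⟨hz.1, hzρ⟩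
  rw [g.normDerivSq_eq hφ (hmd z hz.1).continuousAt hs (hvd.differentiableAt
    ((isOpen_ball.inter isOpen_ball).mem_nhds ⟨hz.1, hzρ⟩))]
  have h1 : g.density φ (φ (f z)) < D := hb' ⟨hzr', ball_subset_closedBall hz.1, hzρ⟩
  have h2 := (g.density_pos hφ (φ.map_source hs)).le
  have h3 := hb z ⟨hz.1, hzr⟩
  gcongr
  exact h2.trans h1.le

theorem exists_normDerivSq_improved_near (hγ : g.IsClosedGeodesic γ)
    (hfc : ContinuousOn f (closedBall 0 1)) (hfd : MDifferentiableOn 𝓘(ℂ) 𝓘(ℂ) f (ball 0 1))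
    (hτ : ContinuousOn τ (sphere 0 1)) (hfτ : ∀ z ∈ sphere (0 : ℂ) 1, f z = γ (τ z))
    (hz₀ : z₀ ∈ sphere (0 : ℂ) 1) {B : ℝ} (hB : 0 < B)
    (hN : ∀ z ∈ ball (0 : ℂ) 1, g.normDerivSq f z ≤ B) :
    ∃ C < B, ∃ r > 0, ∀ z ∈ ball (0 : ℂ) 1 ∩ ball z₀ r, g.normDerivSq f z ≤ C := by
  obtain ⟨ρ, hρ, hsrc⟩ := exists_ball_subset_chart_source hfc hz₀
  set φ := chartAt ℂ (f z₀) with hφd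
  have hφ : φ ∈ atlas ℂ S := chart_mem_atlas ℂ _
  obtain ⟨t₀, ht₀⟩ := QuotientAddGroup.mk_surjective (τ z₀)
  replace ht₀ : (t₀ : UnitAddCircle) = τ z₀ := ht₀
  have hz₀n : ‖z₀‖ = 1 := mem_sphere_zero_iff_norm.1 hz₀
  have hγz : γ t₀ = f z₀ := by rw [ht₀, hfτ z₀ hz₀]
  have hts : γ t₀ ∈ φ.source := hγz ▸ mem_chart_source ℂ (f z₀)
  have hvc : ContinuousOn (fun z ↦ φ (f z)) (closedBall 0 1 ∩ ball z₀ ρ) :=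
    φ.continuousOn.comp (hfc.mono inter_subset_left) hsrc
  have hmd : ∀ z ∈ ball (0 : ℂ) 1, MDifferentiableAt 𝓘(ℂ) 𝓘(ℂ) f z := fun z hz ↦
    hfd.mdifferentiableAt (isOpen_ball.mem_nhds hz)
  have hsrc' : ∀ z ∈ ball (0 : ℂ) 1 ∩ ball z₀ ρ, f z ∈ φ.source := fun z hz ↦
    hsrc z ⟨ball_subset_closedBall hz.1, hz.2⟩
  have hvd : DifferentiableOn ℂ (fun z ↦ φ (f z)) (ball 0 1 ∩ ball z₀ ρ) := fun z hz ↦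
    (differentiableAt_chart_comp (hmd z hz.1) hφ (hsrc' z hz)).differentiableWithinAt
  have hcont : Continuous fun t : ℝ ↦ γ t := hγ.1.1.continuous
  have hgeo : ∀ᶠ t in nhds t₀, deriv (deriv fun s : ℝ ↦ φ (γ s)) t +
      g.christoffel φ (φ (γ t)) * (deriv (fun s : ℝ ↦ φ (γ s)) t) ^ 2 = 0 := by
    filter_upwards [hcont.continuousAt (φ.open_source.mem_nhds hts)] with t ht
    exact hγ.1.deriv_deriv hφ ht
  have hσ : ContDiffAt ℝ 2 (g.logDensity φ) (φ (f z₀)) :=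
    (g.contDiffAt_logDensity hφ (φ.map_source (mem_chart_source ℂ (f z₀)))).of_le
      (WithTop.coe_le_coe.2 le_top)
  obtain ⟨Λ', hΛ', r, hr, hb⟩ := exists_improved_bound (σ := g.logDensity φ)
    (Γ := g.christoffel φ) (v := fun z ↦ φ (f z)) hz₀n hρ hvc hvd
    ((contDiffAt_chart_curve hγ.1.1 hφ hts).of_le (m := 3) (WithTop.coe_le_coe.2 le_top))
    (hγ.deriv_ne_zero hφ hts)
    (fun ε hε ↦ eventually_chart_eq_on_sphere hτ hfτ hz₀ φ ht₀ hε) hσ (g.fderiv_logDensity φ) hgeo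
    (Real.sqrt_pos.2 hB) (fun z hz ↦ by
      rw [exp_half_logDensity_mul_norm_deriv g (hmd z hz.1) hφ (hsrc' z hz)]
      exact Real.sqrt_le_sqrt (hN z hz.1))
  refine ⟨(max 0 Λ') ^ 2, ?_, min ρ r, by positivity, fun z hz ↦ ?_⟩
  · rw [← Real.lt_sqrt (le_max_left _ _)]
    exact max_lt (Real.sqrt_pos.2 hB) hΛ'
  · have hzρ : z ∈ ball z₀ ρ := ball_subset_ball (min_le_left _ _) hz.2
    have h1 := hb z ⟨hz.1, ball_subset_ball (min_le_right _ _) hz.2⟩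
    rw [exp_half_logDensity_mul_norm_deriv g (hmd z hz.1) hφ (hsrc' z ⟨hz.1, hzρ⟩)] at h1
    exact (Real.sqrt_le_left (le_max_left _ _)).1 (h1.trans (le_max_right _ _))

theorem exists_normDerivSq_le_of_near_sphere (hg : ∀ p, g.scalarCurvature p ≤ 0)
    (hfd : MDifferentiableOn 𝓘(ℂ) 𝓘(ℂ) f (ball 0 1)) {p : ℝ → Prop}
    (hp : ∀ a b, p a → p b → p (max a b))
    (h : ∀ z₀ ∈ sphere (0 : ℂ) 1, ∃ C, p C ∧ ∃ r > 0, ∀ z ∈ ball (0 : ℂ) 1 ∩ ball z₀ r,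
      g.normDerivSq f z ≤ C) :
    ∃ C, p C ∧ ∀ z ∈ ball (0 : ℂ) 1, g.normDerivSq f z ≤ C := by
  obtain ⟨C, hC, R, hR, hb⟩ := exists_bound_near_sphere hp h
  refine ⟨C, hC, fun z hz ↦ ?_⟩
  obtain ⟨R', hRR', hR'⟩ := exists_between (max_lt hR (mem_ball_zero_iff.1 hz))
  obtain ⟨h1, h2⟩ := max_lt_iff.1 hRR'
  have h3 : 0 ≤ R' := (norm_nonneg z).trans h2.le
  have h4 : ∀ w ∈ sphere (0 : ℂ) R', g.normDerivSq f w ≤ C := fun w hw ↦ by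
    rw [mem_sphere_zero_iff_norm] at hw
    exact hb w (by rwa [mem_ball_zero_iff, hw]) (by rwa [hw])
  refine g.normDerivSq_le_of_sphere hg isOpen_ball hfd ?_ (closedBall_subset_ball hR') h4
    (mem_closedBall_zero_iff.2 h2.le)
  refine le_trans ?_ (h4 (R' : ℂ) (by simp [abs_of_nonneg h3]))
  exact mul_nonneg (sq_nonneg _) (g.unitNormSq_pos _).le

theorem eventually_eq_of_normDerivSq_eq_zero {U : Set ℂ} (hU : IsOpen U)
    (hf : MDifferentiableOn 𝓘(ℂ) 𝓘(ℂ) f U) (h0 : ∀ z ∈ U, g.normDerivSq f z = 0) {z : ℂ}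
    (hz : z ∈ U) : ∀ᶠ x in nhds z, f x = f z := by
  set φ := chartAt ℂ (f z)
  have hφ : φ ∈ atlas ℂ S := chart_mem_atlas ℂ _
  have hs : f z ∈ φ.source := mem_chart_source ℂ (f z)
  have h1 : ∀ᶠ x in nhds z, f x ∈ φ.source ∧ x ∈ U ∧ deriv (fun x ↦ φ (f x)) x = 0 := by
    filter_upwards [hU.mem_nhds hz, normDerivSq_eventuallyEq g hU hf hz hφ hs,
      (hf.mdifferentiableAt (hU.mem_nhds hz)).continuousAt (φ.open_source.mem_nhds hs)]
      with x hx hx' hxs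
    rw [h0 x hx] at hx'
    refine ⟨hxs, hx, ?_⟩
    rcases mul_eq_zero.1 hx'.symm with h | h
    · exact absurd h (g.density_pos hφ (φ.map_source hxs)).ne'
    · exact norm_eq_zero.1 (pow_eq_zero_iff two_ne_zero |>.1 h)
  obtain ⟨r, hr, hb⟩ := Metric.mem_nhds_iff.1 h1
  filter_upwards [ball_mem_nhds z hr] with x hx
  refine φ.injOn (hb hx).1 hs ?_
  exact isOpen_ball.is_const_of_deriv_eq_zero (convex_ball z r).isPreconnected
    (fun y hy ↦ (differentiableAt_chart_comp (hf.mdifferentiableAt (hU.mem_nhds (hb hy).2.1)) hφ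
      (hb hy).1).differentiableWithinAt) (fun y hy ↦ (hb hy).2.2) hx (mem_ball_self hr)

/-- A holomorphic disc in a nonpositively curved Riemann surface with boundary on a closed geodesic
is constant. -/
theorem eqOn_const_of_boundary_on_closedGeodesic [T2Space S] (hg : ∀ p, g.scalarCurvature p ≤ 0)
    (hγ : g.IsClosedGeodesic γ)
    (hfc : ContinuousOn f (closedBall 0 1)) (hfd : MDifferentiableOn 𝓘(ℂ) 𝓘(ℂ) f (ball 0 1))
    (hτ : ContinuousOn τ (sphere 0 1)) (hfτ : ∀ z ∈ sphere (0 : ℂ) 1, f z = γ (τ z)) :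
    EqOn f (fun _ ↦ f 0) (closedBall 0 1) := by
  obtain ⟨C, -, hC⟩ := exists_normDerivSq_le_of_near_sphere hg hfd (p := fun _ ↦ True)
    (fun _ _ _ _ ↦ trivial) (fun z₀ hz₀ ↦ by
      obtain ⟨C, hC⟩ := exists_normDerivSq_bound_near hγ hfc hfd hτ hfτ hz₀
      exact ⟨C, trivial, hC⟩)
  have hbdd : BddAbove (g.normDerivSq f '' ball 0 1) := ⟨C, by rintro _ ⟨z, hz, rfl⟩; exact hC z hz⟩
  set B := sSup (g.normDerivSq f '' ball 0 1) with hBd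
  have hN : ∀ z ∈ ball (0 : ℂ) 1, g.normDerivSq f z ≤ B := fun z hz ↦
    le_csSup hbdd (mem_image_of_mem _ hz)
  have hB : B ≤ 0 := by
    by_contra! hB
    obtain ⟨C', hC'B, hC'⟩ := exists_normDerivSq_le_of_near_sphere hg hfd (p := fun C ↦ C < B)
      (fun _ _ ↦ max_lt) (fun z₀ hz₀ ↦
        exists_normDerivSq_improved_near hγ hfc hfd hτ hfτ hz₀ hB hN)
    refine hC'B.not_ge (csSup_le ((nonempty_ball.2 one_pos).image _) ?_)
    rintro _ ⟨z, hz, rfl⟩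
    exact hC' z hz
  have h0 : ∀ z ∈ ball (0 : ℂ) 1, g.normDerivSq f z = 0 := fun z hz ↦
    le_antisymm ((hN z hz).trans hB) (mul_nonneg (sq_nonneg _) (g.unitNormSq_pos _).le)
  have hloc : IsLocallyConstant (fun x : ball (0 : ℂ) 1 ↦ f x) := by
    rw [IsLocallyConstant.iff_eventually_eq]
    intro x
    exact continuous_subtype_val.continuousAt.eventually
      (eventually_eq_of_normDerivSq_eq_zero isOpen_ball hfd h0 x.2)
  have : PreconnectedSpace (ball (0 : ℂ) 1) :=
    Subtype.preconnectedSpace (convex_ball (0 : ℂ) 1).isPreconnected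
  have heq : EqOn f (fun _ ↦ f 0) (ball 0 1) := fun z hz ↦
    hloc.apply_eq_of_preconnectedSpace ⟨z, hz⟩ ⟨0, mem_ball_self one_pos⟩
  exact heq.of_subset_closure hfc continuousOn_const ball_subset_closedBall
    (closure_ball (0 : ℂ) one_ne_zero).ge

end Boundary

end KahlerMetric

section Components

variable {n : ℕ} {S : Fin n → Type*} [∀ j, TopologicalSpace (S j)] [∀ j, ChartedSpace ℂ (S j)]
  {f : ℂ → ∀ j, S j}

theorem mdifferentiableWithinAt_pi_apply {s : Set ℂ} {z : ℂ}
    (h : MDifferentiableWithinAt 𝓘(ℂ) (ModelWithCorners.pi fun _ : Fin n ↦ 𝓘(ℂ)) f s z)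
    (j : Fin n) : MDifferentiableWithinAt 𝓘(ℂ) 𝓘(ℂ) (fun z ↦ f z j) s z := by
  obtain ⟨hc, hd⟩ := h
  exact ⟨(continuous_apply j).continuousAt.comp_continuousWithinAt hc,
    (differentiableWithinAt_pi.1 hd) j⟩

end Components

theorem exists_continuousOn_lift_of_injective {X Y : Type*} [TopologicalSpace X] [CompactSpace X]
    [TopologicalSpace Y] [T2Space Y] {γ : X → Y} (hγ : Continuous γ) (hi : Function.Injective γ)
    {Z : Type*} [TopologicalSpace Z] {s : Set Z} {f : Z → Y} (hf : ContinuousOn f s)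
    [Nonempty X] (hfs : ∀ z ∈ s, f z ∈ range γ) :
    ∃ τ : Z → X, ContinuousOn τ s ∧ ∀ z ∈ s, f z = γ (τ z) := by
  have h : ∀ z ∈ s, f z = γ (Function.invFun γ (f z)) := fun z hz ↦
    (Function.invFun_eq (hfs z hz)).symm
  refine ⟨fun z ↦ Function.invFun γ (f z), ?_, h⟩
  rw [(hγ.isClosedEmbedding hi).isInducing.continuousOn_iff]
  exact hf.congr fun z hz ↦ (h z hz).symm

theorem mainTheorem7 {n : ℕ} (S : Fin n → Type*)
    [∀ j, TopologicalSpace (S j)] [∀ j, T2Space (S j)] [∀ j, ConnectedSpace (S j)]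
    [∀ j, ChartedSpace ℂ (S j)] [∀ j, IsManifold 𝓘(ℂ) ω (S j)]
    (g : ∀ j, KahlerMetric (S j)) (hg : ∀ j p, (g j).scalarCurvature p ≤ 0)
    (γ : ∀ j, UnitAddCircle → S j) (hγ : ∀ j, (g j).IsClosedGeodesic (γ j)) :
    -- Simple closed geodesics: the torus is the embedded submanifold `∏ j, γ j (S¹)`.
    ((∀ j, Function.Injective (γ j)) →
      ¬ ∃ f : ℂ → ∀ j, S j, IsNonconstantHolomorphicDisc f ∧
        ∀ z ∈ Metric.sphere (0 : ℂ) 1, f z ∈ Set.univ.pi fun j ↦ Set.range (γ j)) ∧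
    -- Arbitrary closed geodesics: the torus is immersed, and the boundary of the disc is a
    -- loop in the torus.
    (¬ ∃ f : ℂ → ∀ j, S j, IsNonconstantHolomorphicDisc f ∧
        ∃ τ : ℂ → Fin n → UnitAddCircle, ContinuousOn τ (Metric.sphere 0 1) ∧
          ∀ z ∈ Metric.sphere (0 : ℂ) 1, ∀ j, f z j = γ j (τ z j)) := by
  have key : ∀ f : ℂ → ∀ j, S j, IsNonconstantHolomorphicDisc f →
      (∀ j, ∃ τ : ℂ → UnitAddCircle, ContinuousOn τ (sphere 0 1) ∧
        ∀ z ∈ sphere (0 : ℂ) 1, f z j = γ j (τ z)) → False := by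
    rintro f ⟨hfc, hfd, z, hz, w, hw, hne⟩ hτ
    refine hne (funext fun j ↦ ?_)
    obtain ⟨τ, hτc, hfτ⟩ := hτ j
    have h := KahlerMetric.eqOn_const_of_boundary_on_closedGeodesic (f := fun z ↦ f z j) (hg j)
      (hγ j) (continuousOn_pi.1 hfc j)
      (fun z hz ↦ mdifferentiableWithinAt_pi_apply (hfd z hz) j) hτc hfτ
    exact (h hz).trans (h hw).symm
  refine ⟨?_, ?_⟩
  · rintro hi ⟨f, hf, hfb⟩
    refine key f hf fun j ↦ exists_continuousOn_lift_of_injective ?_ (hi j)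
      ((continuousOn_pi.1 hf.1 j).mono sphere_subset_closedBall) fun z hz ↦ hfb z hz j trivial
    exact isQuotientMap_quotient_mk'.continuous_iff.2 (hγ j).1.1.continuous
  · rintro ⟨f, hf, τ, hτ, hfτ⟩
    exact key f hf fun j ↦ ⟨fun z ↦ τ z j, continuousOn_pi.1 hτ j, fun z hz ↦ hfτ z hz j⟩
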